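/- **Setting.** Treeplexes are built from probability simplexes $\Delta_m=\{x\in[0,1]^m:\sum_i x_i=1\}$ by finite Cartesian products and by branching $\mathcal Z_1\,\boxed{i}\,\mathcal Z_2=\{(u,u_i v):u\in\mathcal Z_1,v\in\mathcal Z_2\}$. The simplexes used are the information sets $h\in\mathcal H$; $\Omega_h$ is the set of indices of $h$, $h(i)$ the information set containing index $i$, and $\sigma(h)$ the index on which $h$ was branched (with $z_{\sigma(h)}:=1$ if there is none). For $z$ in the treeplex write $q_i=z_i/z_{\sigma(h(i))}$ and $q_h=(q_i)_{i\in\Omega_h}$; conversely $q$ determines $z$. A two-player zero-sum extensive-form game in sequence form is $\min_{x\in\mathcal X}\max_{y\in\mathcal Y}x^\top A y$ with treeplexes $\mathcal X,\mathcal Y$ and a real matrix $A$. Put $z=(x,y)$, $\mathcal Z=\mathcal X\times\mathcal Y$, $F(z)=(Ay,-A^\top x)$. For $\gamma\ge 0$ the $\gamma$-perturbed game has the strategy set $\mathcal Z^\gamma=\{z\in\mathcal Z: q_i\ge\gamma\ \forall i\}$ (so $\mathcal Z^0=\mathcal Z$) and the duality gap $\mathrm{gap}_\gamma(z)=\max_{\hat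 z\in\mathcal Z^\gamma}F(z)^\top(z-\hat z)$; its zeros in $\mathcal Z^\gamma$ are the Nash equilibria of the $\gamma$-perturbed game, and $\gamma=0$ is the original game. For $\gamma>0$ assume $\gamma|\Omega_h|\le1$ for all $h$, so that $\mathcal Z^\gamma\ne\emptyset$. **Algorithm (Reg-CFR with the Euclidean regularizer).** Let $\psi(p)=\sum_i p_i^2$, with Bregman divergence $D(u,v)=\psi(u)-\psi(v)-\langle\nabla\psi(v),u-v\rangle$, let $\alpha_h>0$ be weights, $\tau>0$, $\kappa\ge1$. For $h\in\mathcal H$ set, recursively over the tree, $$W^h(z)=\langle q_h,V^h(z)\rangle+\tau\alpha_h\psi(q_h),\qquad V^h(z)=\Big(F(z)_i+\sum_{h':\sigma(h')=i}W^{h'}(z)\Big)_{i\in\Omega_h}.$$ Start from uniform $q_{0,h}=q_{1/2,h}$ and for $t=1,2,\dots$ and every $h$ let $$q_{t,h}=\arg\min_{p\in\Delta^\gamma_{|\Omega_h|}}\langle V^h(z_{t-\frac12})+\tau\alpha_h\nabla\psi(q_{t-1,h}),p\rangle+\lambda^h_{t-1}D(p,q_{t-1,h})+(\lambda^h_t-\lambda^h_{t-1})D(p,q_{1,h}),$$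 $$q_{t+\frac12,h}=\arg\min_{p\in\Delta^\gamma_{|\Omega_h|}}\langle V^h(z_{t-\frac12})+\tau\alpha_h\nabla\psi(q_{t,h}),p\rangle+\lambda^h_tD(p,q_{t,h}),$$ where $\Delta^\gamma=\{p\in\Delta:p_i\ge\gamma\ \forall i\}$, $\lambda^h_t=\big(\kappa+\sum_{s=1}^{t-1}\|V^h(z_{s+\frac12})-V^h(z_{s-\frac12})\|_2^2\big)^{1/2}$ (so $\lambda_0^h=\lambda_1^h=\sqrt\kappa$), and $z_t$, $z_{t+\frac12}$ are the sequence forms of $q_t$, $q_{t+\frac12}$. **Corollary.** There is $c_2>0$, depending only on the game and on $\alpha$, such that for every $0<c_1\le c_2$ and $\kappa\ge 1$, with the choice $\tau\in[c_1\varepsilon,c_2\varepsilon]$ (that is, $\tau=\Theta(\varepsilon)$) for a target duality gap $\varepsilon>0$: 1. ($\gamma=0$, best-iterate rate $O(T^{-1/4})$.) There is $C>0$, depending only on the game, $\alpha$, $c_1$, $c_2$ and $\kappa$, such that for all $\varepsilon>0$, all $\tau\in[c_1\varepsilon,c_2\varepsilon]$ and all integers $T\ge1$ with $C\,T^{-1/4}\le\varepsilon$,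 the iterates of Reg-CFR satisfy $\min_{1\le t\le T}\mathrm{gap}_0(z_t)\le\varepsilon$. In particular, $\varepsilon=C\,T^{-1/4}$ and $\tau=\Theta(T^{-1/4})$ give $\min_{1\le t\le T}\mathrm{gap}_0(z_t)\le C\,T^{-1/4}$. 2. ($\gamma>0$, asymptotic last-iterate convergence.) For every such $\gamma$, every $\varepsilon>0$ and every $\tau\in[c_1\varepsilon,c_2\varepsilon]$ there is $T_0$ such that the iterates of Reg-CFR on the $\gamma$-perturbed game satisfy $\mathrm{gap}_\gamma(z_t)\le\varepsilon$ for all $t\ge T_0$. -/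

import Mathlib

/-- Treeplexes, built from probability simplexes by Cartesian products and by branching on an
index.  `H` is the set of information sets and `I` the set of indices (coordinates); both are
computed along the construction.  `simplex n` is the simplex on `n + 1` coordinates. -/
inductive Treeplex : Type → Type → Type 1
  | simplex (n : ℕ) : Treeplex Unit (Fin (n + 1))
  | prod {H₁ I₁ H₂ I₂ : Type} (Z₁ : Treeplex H₁ I₁) (Z₂ : Treeplex H₂ I₂) :
      Treeplex (H₁ ⊕ H₂) (I₁ ⊕ I₂)
  | branch {H₁ I₁ H₂ I₂ : Type} (Z₁ : Treeplex H₁ I₁) (i : I₁) (Z₂ : Treeplex H₂ I₂) :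
      Treeplex (H₁ ⊕ H₂) (I₁ ⊕ I₂)

namespace Treeplex

/-- The subset of `ℝ^I` described by a treeplex; branching is
`{(u, uᵢ • v) : u ∈ Z₁, v ∈ Z₂}`. -/
def carrier : {H I : Type} → Treeplex H I → Set (I → ℝ)
  | _, _, simplex n => stdSimplex ℝ (Fin (n + 1))
  | _, _, prod Z₁ Z₂ => {z | ∃ u ∈ Z₁.carrier, ∃ v ∈ Z₂.carrier, z = Sum.elim u v}
  | _, _, branch Z₁ i Z₂ => {z | ∃ u ∈ Z₁.carrier, ∃ v ∈ Z₂.carrier, z = Sum.elim u (u i • v)}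

/-- `h(i)`: the information set to which an index belongs. -/
def infoset : {H I : Type} → Treeplex H I → I → H
  | _, _, simplex _ => fun _ => ()
  | _, _, prod Z₁ Z₂ => Sum.map Z₁.infoset Z₂.infoset
  | _, _, branch Z₁ _ Z₂ => Sum.map Z₁.infoset Z₂.infoset

/-- `σ(h)`: the index of the parent variable of an information set; `none` at a root. -/
def parent : {H I : Type} → Treeplex H I → H → Option I
  | _, _, simplex _ => fun _ => none
  | _, _, prod Z₁ Z₂ =>
      Sum.elim (fun h => (Z₁.parent h).map Sum.inl) (fun h => (Z₂.parent h).map Sum.inr)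
  | _, _, branch Z₁ i Z₂ =>
      Sum.elim (fun h => (Z₁.parent h).map Sum.inl)
        (fun h => some ((Z₂.parent h).elim (Sum.inl i) Sum.inr))

/-- The sequence-form vector `z` of a behavioral (conditional-form) strategy `q`:
`zᵢ = qᵢ * z_{σ(h(i))}`, where `z_{σ(h)} = 1` at a root. -/
def toSeq : {H I : Type} → Treeplex H I → (I → ℝ) → I → ℝ
  | _, _, simplex _ => fun q => q
  | _, _, prod Z₁ Z₂ => fun q => Sum.elim (Z₁.toSeq (q ∘ Sum.inl)) (Z₂.toSeq (q ∘ Sum.inr))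
  | _, _, branch Z₁ i Z₂ => fun q =>
      Sum.elim (Z₁.toSeq (q ∘ Sum.inl)) (Z₁.toSeq (q ∘ Sum.inl) i • Z₂.toSeq (q ∘ Sum.inr))

/-- The number of information sets. -/
def size : {H I : Type} → Treeplex H I → ℕ
  | _, _, simplex _ => 1
  | _, _, prod Z₁ Z₂ => Z₁.size + Z₂.size
  | _, _, branch Z₁ _ Z₂ => Z₁.size + Z₂.size

/-- A rank on information sets that drops strictly from a node to its children; it serves only
to justify recursion over the tree. -/
def height : {H I : Type} → Treeplex H I → H → ℕ
  | _, _, simplex _ => fun _ => 0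
  | _, _, prod Z₁ Z₂ => Sum.elim Z₁.height Z₂.height
  | _, _, branch Z₁ _ Z₂ => Sum.elim (fun h => Z₁.height h + Z₂.size) Z₂.height

theorem height_lt_size {H I : Type} (Z : Treeplex H I) (h : H) : Z.height h < Z.size := by
  induction Z with
  | simplex n => simp [height, size]
  | prod Z₁ Z₂ ih₁ ih₂ =>
    rcases h with h | h
    · have := ih₁ h
      simp only [height, size, Sum.elim_inl]; omega
    · have := ih₂ h
      simp only [height, size, Sum.elim_inr]; omega
  | branch Z₁ i Z₂ ih₁ ih₂ =>
    rcases h with h | h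
    · have := ih₁ h
      simp only [height, size, Sum.elim_inl]; omega
    · have := ih₂ h
      simp only [height, size, Sum.elim_inr]; omega

theorem height_lt {H I : Type} (Z : Treeplex H I) {h : H} {i : I} (hp : Z.parent h = some i) :
    Z.height h < Z.height (Z.infoset i) := by
  induction Z with
  | simplex n => simp [parent] at hp
  | prod Z₁ Z₂ ih₁ ih₂ =>
    rcases h with h | h
    · simp only [parent, Sum.elim_inl, Option.map_eq_some_iff] at hp
      obtain ⟨j, hj, rfl⟩ := hp
      simpa [height, infoset] using ih₁ hj
    · simp only [parent, Sum.elim_inr, Option.map_eq_some_iff] at hp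
      obtain ⟨j, hj, rfl⟩ := hp
      simpa [height, infoset] using ih₂ hj
  | branch Z₁ k Z₂ ih₁ ih₂ =>
    rcases h with h | h
    · simp only [parent, Sum.elim_inl, Option.map_eq_some_iff] at hp
      obtain ⟨j, hj, rfl⟩ := hp
      simpa [height, infoset] using ih₁ hj
    · simp only [parent, Sum.elim_inr, Option.some.injEq] at hp
      cases hj : Z₂.parent h with
      | none =>
        rw [hj] at hp
        subst hp
        have := Z₂.height_lt_size h
        simp only [height, infoset, Option.elim_none, Sum.map_inl, Sum.elim_inl, Sum.elim_inr]
        omega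
      | some j =>
        rw [hj] at hp
        subst hp
        simpa [height, infoset] using ih₂ hj

section

variable {H I : Type} (Z : Treeplex H I)

/-- `Ω_h`: the indices (actions) that belong to the information set `h`. -/
abbrev Act (h : H) : Type := {i : I // Z.infoset i = h}

/-- The slice of a vector on an information set. -/
def slice (q : I → ℝ) (h : H) : Z.Act h → ℝ := fun i => q i

/-- `z_{σ(h)}`, with value `1` at a root. -/
def parentMass (z : I → ℝ) (h : H) : ℝ := (Z.parent h).elim 1 z

/-- The `γ`-perturbed treeplex: `zᵢ / z_{σ(h(i))} ≥ γ` for all indices `i`.  (For `γ > 0` the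
multiplied-out form forces all coordinates to be positive; for `γ = 0` it is no restriction.) -/
def perturbed (γ : ℝ) : Set (I → ℝ) :=
  {z | z ∈ Z.carrier ∧ ∀ i, γ * Z.parentMass z (Z.infoset i) ≤ z i}

end

end Treeplex

/-- The `γ`-perturbed probability simplex. -/
def perturbedSimplex (γ : ℝ) (ι : Type) [Fintype ι] : Set (ι → ℝ) :=
  {p | p ∈ stdSimplex ℝ ι ∧ ∀ i, γ ≤ p i}

/-- The Euclidean base regularizer `ψ(p) = ∑ pᵢ²`. -/
def euclReg {ι : Type} [Fintype ι] (p : ι → ℝ) : ℝ := ∑ i, p i ^ 2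

/-- The gradient of the Euclidean base regularizer. -/
def euclRegGrad {ι : Type} (p : ι → ℝ) : ι → ℝ := fun i => 2 * p i

/-- The Bregman divergence `ψ(u) - ψ(v) - ⟨∇ψ(v), u - v⟩` of the Euclidean base regularizer. -/
def bregman {ι : Type} [Fintype ι] (u v : ι → ℝ) : ℝ :=
  euclReg u - euclReg v - euclRegGrad v ⬝ᵥ (u - v)

namespace Treeplex

section

variable {H I : Type} [Fintype H] [DecidableEq H] [Fintype I] [DecidableEq I] (Z : Treeplex H I)

/-- `W^h`: the regularized value of the subtree rooted at `h` under the behavioral strategy `q`,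
when index `i` carries the loss `gᵢ`:
`W^h = ∑_{i ∈ Ω_h} qᵢ (gᵢ + ∑_{h' : σ(h') = i} W^{h'}) + τ α_h ψ(q_h)`. -/
noncomputable def W (α : H → ℝ) (τ : ℝ) (g q : I → ℝ) (h : H) : ℝ :=
  ∑ i : Z.Act h, q i.1 * (g i.1 + ∑ h' : {h' : H // Z.parent h' = some i.1}, W α τ g q h'.1)
    + τ * α h * euclReg (Z.slice q h)
termination_by Z.height h
decreasing_by
  have hlt := Z.height_lt h'.2
  rw [i.2] at hlt
  exact hlt

/-- `V^h(z)`, where `z` is the sequence form of `q` and the loss vector is `F z`: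
`V^h = (F(z)ᵢ + ∑_{h' : σ(h') = i} W^{h'})_{i ∈ Ω_h}`. -/
noncomputable def V (F : (I → ℝ) → I → ℝ) (α : H → ℝ) (τ : ℝ) (q : I → ℝ) (h : H) :
    Z.Act h → ℝ := fun i =>
  F (Z.toSeq q) i.1
    + ∑ h' : {h' : H // Z.parent h' = some i.1}, Z.W α τ (F (Z.toSeq q)) q h'.1

/-- `δ_s^h = ‖V^h(z_{s+1/2}) - V^h(z_{s-1/2})‖²` (Euclidean norm), for `s ≥ 1`; here `qHalf s` is
the behavioral strategy of `z_{s+1/2}`. -/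
noncomputable def variation (F : (I → ℝ) → I → ℝ) (α : H → ℝ) (τ : ℝ) (qHalf : ℕ → I → ℝ)
    (h : H) (s : ℕ) : ℝ :=
  ∑ i, (Z.V F α τ (qHalf s) h i - Z.V F α τ (qHalf (s - 1)) h i) ^ 2

/-- The adaptive stepsize `λ_t^h = √(κ + ∑_{s=1}^{t-1} δ_s^h)`. -/
noncomputable def stepsize (F : (I → ℝ) → I → ℝ) (α : H → ℝ) (τ κ : ℝ) (qHalf : ℕ → I → ℝ)
    (h : H) (t : ℕ) : ℝ :=
  √(κ + ∑ s ∈ Finset.Ico 1 t, Z.variation F α τ qHalf h s)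

/-- `(q_t)` and `(q_{t+1/2})` (`q t` and `qHalf t`, `t = 0, 1, 2, …`) are the behavioral
strategies produced by a run of Reg-CFR with the Euclidean base regularizer on the
`γ`-perturbed treeplex `Z` with loss operator `F`.  (In the first step the anchor `q 1` enters
with the coefficient `λ₁ - λ₀ = 0`.) -/
structure IsRegCFR (F : (I → ℝ) → I → ℝ) (α : H → ℝ) (τ κ γ : ℝ) (q qHalf : ℕ → I → ℝ) :
    Prop where
  init : ∀ i, q 0 i = 1 / Fintype.card (Z.Act (Z.infoset i))
  init_half : ∀ i, qHalf 0 i = 1 / Fintype.card (Z.Act (Z.infoset i))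
  mem : ∀ t h, Z.slice (q (t + 1)) h ∈ perturbedSimplex γ (Z.Act h)
  mem_half : ∀ t h, Z.slice (qHalf (t + 1)) h ∈ perturbedSimplex γ (Z.Act h)
  step : ∀ t h, IsMinOn
    (fun p : Z.Act h → ℝ =>
      (Z.V F α τ (qHalf t) h + (τ * α h) • euclRegGrad (Z.slice (q t) h)) ⬝ᵥ p
        + Z.stepsize F α τ κ qHalf h t * bregman p (Z.slice (q t) h)
        + (Z.stepsize F α τ κ qHalf h (t + 1) - Z.stepsize F α τ κ qHalf h t)
            * bregman p (Z.slice (q 1) h))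
    (perturbedSimplex γ (Z.Act h)) (Z.slice (q (t + 1)) h)
  step_half : ∀ t h, IsMinOn
    (fun p : Z.Act h → ℝ =>
      (Z.V F α τ (qHalf t) h + (τ * α h) • euclRegGrad (Z.slice (q (t + 1)) h)) ⬝ᵥ p
        + Z.stepsize F α τ κ qHalf h (t + 1) * bregman p (Z.slice (q (t + 1)) h))
    (perturbedSimplex γ (Z.Act h)) (Z.slice (qHalf (t + 1)) h)

end

end Treeplex

/-- The operator `F(x, y) = (A y, -Aᵀ x)` of the saddle-point problem `min_x max_y xᵀ A y`. -/
def gameOp {IX IY : Type} [Fintype IX] [Fintype IY] (A : Matrix IX IY ℝ) (z : IX ⊕ IY → ℝ) :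
    IX ⊕ IY → ℝ :=
  Sum.elim (A.mulVec (z ∘ Sum.inr)) (-(A.transpose.mulVec (z ∘ Sum.inl)))

/-- The duality gap `max_{ẑ ∈ S} F(z)ᵀ (z - ẑ)` of `z` in the game with (compact, non-empty) joint
strategy set `S`. -/
noncomputable def dualityGap {IX IY : Type} [Fintype IX] [Fintype IY] (A : Matrix IX IY ℝ)
    (S : Set (IX ⊕ IY → ℝ)) (z : IX ⊕ IY → ℝ) : ℝ :=
  sSup ((fun z' => gameOp A z ⬝ᵥ (z - z')) '' S)

/-!
Regularization turns the game into one with an equilibrium `z*` around which the regularized loss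
grows quadratically: `F(z*)ᵀ(z - z*) + τ (Ψ(z) - Ψ(z*)) ≥ τ ∑_h z_{σ(h)} α_h ‖q_h - q*_h‖²`, where
`Ψ` is the dilated regularizer.  Since `F` is skew, the left-hand side at `z = z_{t+1/2}` is also
the regularized regret of the step against `z*`, and it decomposes over the information sets into
local regrets with weights `z*_{σ(h)}` (`Treeplex.regret_decomposition`).  Each local regret is at
most a multiple of the final inverse stepsize `λ^h` (`ProxRun.regret_le`).  So, with
`S = ∑_t ∑_h z_{t+1/2,σ(h)} ‖q_{t+1/2,h} - q*_h‖²`, one has `τ S = O(∑_h λ^h)`.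

It remains to bound `λ^h`, that is, the squared variation of the counterfactual losses `V^h`.  The
part that comes from `F(z)` is controlled by the squared variation of the sequence form `z`, hence
by `S`.  The other part comes from the values `W^{h'}` of the children.  Those may sit at information
sets that are hardly reached, where `q_{h'}` moves freely and is not controlled by `S`.  However, the
value `W = ⟨V, q⟩ + τ α ψ(q)` is insensitive to such moves: a step of length `u` changes it by about
`λ u²` only, and `∑ (λ u²)²` is bounded by the squared variation of `V^{h'}` itself
(`sum_sq_energy_le`, `ProxRun.sum_sq_value_sub_le`).  Induction from the leaves gives
`(λ^h)² = O(1 + S)` for all `h` (`Treeplex.exists_sum_sq_V_sub_le`).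

Together, `τ S = O(√(1 + S))`, so `S = O(τ⁻²)`; the iterates `z_t` are as close to `z*` as the
`z_{t+1/2}` are, up to the same variations (`Treeplex.exists_sum_sq_le`).  The duality gap of `z` is
at most `τ ∑_h α_h + O(‖z - z*‖)`.  Among `T` iterates the best has `‖z_t - z*‖ = O(1 / (τ √T))`,
which for `τ = Θ(ε)` is `O(ε)` as soon as `T ≥ (C / ε)⁴`; and `∑_t ‖z_t - z*‖² < ∞` gives the
convergence of the last iterate.

The equilibrium is obtained from the run itself: since `λ^h_T = O(√T)` trivially, a cluster point of
the averaged strategies is one (`Treeplex.exists_equilibrium`).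
-/

set_option linter.unusedSectionVars false

/-! ### Energy estimate for scalar sequences -/

/-- One step of the energy estimate, with `X = l u²` before and after the step (unprimed and
primed): multiply the descent inequality for the gap `g` by `X'` and absorb the cross terms. -/
theorem energy_step {M K u u' g g' l l' w w' : ℝ} (hM : 1 ≤ M) (hK : K = 2 * (M + 2) * M + M)
    (hu : 0 ≤ u) (hu2 : u ≤ 2) (hu' : 0 ≤ u') (hu2' : u' ≤ 2) (hg : 0 ≤ g)
    (hw : 0 ≤ w) (hw' : 0 ≤ w') (hl : 1 ≤ l) (hmono : l ≤ l') (hstep : l' ≤ l + w)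
    (hdrop : g' ≤ g - l' * u' ^ 2 + M * w') (hgap : g ≤ M * (l * u + w))
    (hinc : l' * (u' - u) ≤ M * (w + w')) :
    3 / 4 * (l' * u' ^ 2) ^ 2 + l' * u' ^ 2 * g' - l * u ^ 2 * g - 1 / 4 * (l * u ^ 2) ^ 2
      ≤ (4 * K ^ 2 + 4 * K) * (w ^ 2 + w' ^ 2) := by
  have hKpos : 1 ≤ K := by nlinarith
  have hX : 0 ≤ l * u ^ 2 := mul_nonneg (by linarith) (sq_nonneg _)
  have hX' : 0 ≤ l' * u' ^ 2 := mul_nonneg (by linarith) (sq_nonneg _)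
  have hs0 : 0 ≤ w + w' := add_nonneg hw hw'
  have h1 : (l' * u' ^ 2) ^ 2 ≤ l' * u' ^ 2 * (g - g' + M * w') := by
    rw [pow_two (l' * u' ^ 2)]
    exact mul_le_mul_of_nonneg_left (by linarith) hX'
  have h2 : l' * u' ^ 2 - l * u ^ 2 ≤ (M + 2) * (w + w') * (u' + u) := by
    have e1 : l' * u' ^ 2 - l * u ^ 2 = (l' * (u' - u)) * (u' + u) + (l' - l) * u ^ 2 := by ring
    have e2 : (l' * (u' - u)) * (u' + u) ≤ (M * (w + w')) * (u' + u) :=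
      mul_le_mul_of_nonneg_right hinc (by linarith)
    have e3 : (l' - l) * u ^ 2 ≤ (w + w') * (2 * u) := by
      refine mul_le_mul (by linarith) ?_ (sq_nonneg _) hs0
      rw [pow_two]
      exact mul_le_mul_of_nonneg_right hu2 hu
    have e4 := mul_nonneg hs0 hu'
    rw [e1]
    calc _ ≤ (M * (w + w')) * (u' + u) + (w + w') * (2 * u) := add_le_add e2 e3
      _ ≤ _ := by linarith
  have h4 : (u' + u) * (l * u) ≤ 2 * (l' * u' ^ 2 + l * u ^ 2) := by
    have e1 : l * u' ^ 2 ≤ l' * u' ^ 2 := mul_le_mul_of_nonneg_right hmono (sq_nonneg _)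
    have e2 : l * (u' * u) ≤ l * ((u' ^ 2 + u ^ 2) / 2) :=
      mul_le_mul_of_nonneg_left (by linarith [sq_nonneg (u' - u), sub_sq u' u]) (by linarith)
    linarith
  generalize hs : w + w' = s at *
  have h3 : (l' * u' ^ 2 - l * u ^ 2) * g ≤ (M + 2) * s * (u' + u) * (M * (l * u + s)) := by
    have hE : 0 ≤ (M + 2) * s * (u' + u) := by positivity
    refine (mul_le_mul_of_nonneg_right h2 hg).trans (mul_le_mul_of_nonneg_left ?_ hE)
    exact hgap.trans (mul_le_mul_of_nonneg_left (by linarith) (by linarith))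
  have h5 : (l' * u' ^ 2 - l * u ^ 2) * g
      ≤ (M + 2) * M * (2 * s * (l' * u' ^ 2 + l * u ^ 2) + 4 * s ^ 2) := by
    refine h3.trans ?_
    have e : (M + 2) * s * (u' + u) * (M * (l * u + s))
        = (M + 2) * M * (s * ((u' + u) * (l * u)) + (u' + u) * s ^ 2) := by ring
    rw [e]
    refine mul_le_mul_of_nonneg_left ?_ (by positivity)
    have a1 := mul_le_mul_of_nonneg_left h4 hs0
    have a2 : (u' + u) * s ^ 2 ≤ 4 * s ^ 2 :=
      mul_le_mul_of_nonneg_right (by linarith) (sq_nonneg _)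
    linarith
  have h8 : s ^ 2 ≤ 2 * (w ^ 2 + w' ^ 2) := by
    rw [← hs]; linarith [sq_nonneg (w - w'), sub_sq w w', add_sq w w']
  have hw's : w' ≤ s := by linarith
  generalize hXe : l * u ^ 2 = X at *
  generalize hXe' : l' * u' ^ 2 = X' at *
  have h6 : X' ^ 2 + X' * g' - X * g ≤ K * (s * (X' + X)) + 2 * K * s ^ 2 := by
    have a1 : M * (X' * w') ≤ M * (s * (X' + X)) := by
      refine mul_le_mul_of_nonneg_left ?_ (by linarith)
      rw [mul_comm s]
      exact mul_le_mul (by linarith) hw's hw' (by linarith)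
    have a3 : 0 ≤ M * s ^ 2 := by positivity
    subst hK
    linarith
  have h7 : K * (s * (X' + X)) ≤ 2 * K ^ 2 * s ^ 2 + 1 / 4 * X' ^ 2 + 1 / 4 * X ^ 2 := by
    linarith [sq_nonneg (2 * K * s - X'), sq_nonneg (2 * K * s - X), sub_sq (2 * K * s) X',
      sub_sq (2 * K * s) X, mul_pow (2 * K) s 2, mul_pow 2 K 2]
  have h9 : (2 * K ^ 2 + 2 * K) * s ^ 2 ≤ (2 * K ^ 2 + 2 * K) * (2 * (w ^ 2 + w' ^ 2)) :=
    mul_le_mul_of_nonneg_left h8 (by positivity)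
  linarith

/-- Energy estimate.  Let `u` be the step lengths of a proximal method with inverse stepsizes `l`,
`g` its suboptimality gaps and `w` the variations of its losses.  If the gap drops by `l u²` up
to `O(w)`, is itself `O(l u + w)`, and `u` grows at most by `O(w / l)` per step, then `∑ (l u²)²`
is controlled by `∑ w²`, with no loss in the number of steps. -/
theorem sum_sq_energy_le (M L : ℝ) (hM : 1 ≤ M) (hL : 1 ≤ L) :
    ∃ C : ℝ, 0 ≤ C ∧ ∀ u g l w : ℕ → ℝ, (∀ t, 0 ≤ u t) → (∀ t, u t ≤ 2) → (∀ t, 0 ≤ g t) →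
      (∀ t, 0 ≤ w t) → (∀ t, w t ≤ M) → (∀ t, 1 ≤ l t) → l 0 ≤ L → (∀ t, l t ≤ l (t + 1)) →
      (∀ t, l (t + 1) ≤ l t + w t) →
      (∀ t, g (t + 1) ≤ g t - l (t + 1) * u (t + 1) ^ 2 + M * w (t + 1)) →
      (∀ t, g t ≤ M * (l t * u t + w t)) →
      (∀ t, l (t + 1) * (u (t + 1) - u t) ≤ M * (w t + w (t + 1))) →
      ∀ N, ∑ t ∈ Finset.range N, (l t * u t ^ 2) ^ 2
        ≤ C * (1 + ∑ t ∈ Finset.range N, w t ^ 2) := by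
  obtain ⟨K, hK⟩ : ∃ K, K = 2 * (M + 2) * M + M := ⟨_, rfl⟩
  obtain ⟨D, hD⟩ : ∃ D, D = 4 * K ^ 2 + 4 * K := ⟨_, rfl⟩
  have hKpos : 0 ≤ K := by rw [hK]; positivity
  have hDpos : 0 ≤ D := by rw [hD]; positivity
  obtain ⟨c, hc⟩ : ∃ c, c = (4 * L) ^ 2 + 4 * L * (M * (2 * L + M)) := ⟨_, rfl⟩
  have hcpos : 0 ≤ c := by rw [hc]; positivity
  refine ⟨2 * (c + 2 * D), by positivity, ?_⟩
  intro u g l w hu hu2 hg hw hwM hl hl0 hmono hstep hdrop hgap hinc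
  obtain ⟨X, hX⟩ : ∃ X : ℕ → ℝ, ∀ t, l t * u t ^ 2 = X t := ⟨_, fun _ => rfl⟩
  have hX0 : ∀ t, 0 ≤ X t := fun t => by
    rw [← hX]; exact mul_nonneg (by linarith [hl t]) (sq_nonneg _)
  have key : ∀ t, 3 / 4 * X (t + 1) ^ 2 + X (t + 1) * g (t + 1) - X t * g t - 1 / 4 * X t ^ 2
      ≤ D * (w t ^ 2 + w (t + 1) ^ 2) := fun t => by
    rw [← hX, ← hX, hD]
    exact energy_step hM hK (hu _) (hu2 _) (hu _) (hu2 _) (hg _) (hw _) (hw _) (hl _) (hmono _)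
      (hstep _) (hdrop _) (hgap _) (hinc _)
  have hX0L : X 0 ≤ 4 * L := by
    have : u 0 ^ 2 ≤ 4 := by
      have := pow_le_pow_left₀ (hu 0) (hu2 0) 2
      linarith
    rw [← hX, mul_comm]
    exact mul_le_mul this hl0 (by linarith [hl 0]) (by norm_num)
  have hg0 : g 0 ≤ M * (2 * L + M) := by
    refine (hgap 0).trans (mul_le_mul_of_nonneg_left ?_ (by linarith))
    have : l 0 * u 0 ≤ L * 2 := mul_le_mul hl0 (hu2 0) (hu 0) (by linarith)
    linarith [hwM 0]
  have hP0 : X 0 * g 0 ≤ 4 * L * (M * (2 * L + M)) :=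
    mul_le_mul hX0L hg0 (hg 0) (by linarith)
  have hX0sq : X 0 ^ 2 ≤ (4 * L) ^ 2 := pow_le_pow_left₀ (hX0 0) hX0L 2
  simp only [hX]
  -- summation by parts: `X N * g N` telescopes, and the remaining terms at `N` are those that
  -- the next use of `key` absorbs
  have main : ∀ N, 1 / 2 * ∑ t ∈ Finset.range (N + 1), X t ^ 2 + X N * g N + 1 / 4 * X N ^ 2
      + D * w N ^ 2 ≤ c + 2 * D * ∑ t ∈ Finset.range (N + 1), w t ^ 2 := by
    intro N
    induction N with
    | zero =>
      simp only [zero_add, Finset.range_one, Finset.sum_singleton]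
      have := mul_nonneg hDpos (sq_nonneg (w 0))
      linarith [sq_nonneg (X 0)]
    | succ N ih =>
      rw [Finset.sum_range_succ, Finset.sum_range_succ (fun t => w t ^ 2)]
      have := key N
      linarith
  intro N
  rcases N with _ | N
  · simp only [Finset.range_zero, Finset.sum_empty]
    linarith
  · have h := main N
    have hs : 0 ≤ ∑ t ∈ Finset.range (N + 1), w t ^ 2 := Finset.sum_nonneg fun _ _ => sq_nonneg _
    have a1 : 0 ≤ X N * g N := mul_nonneg (hX0 _) (hg _)
    have a2 : 0 ≤ D * w N ^ 2 := by positivity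
    have a3 := mul_nonneg hcpos hs
    have a4 := sq_nonneg (X N)
    linarith

/-! ### The proximal recursion at a single information set -/

section ProxRun

variable {E : Type*} [NormedAddCommGroup E] [InnerProductSpace ℝ E]

open scoped RealInnerProductSpace

theorem two_mul_inner_sub_sub (a b x : E) :
    2 * ⟪a - b, x - a⟫ = ‖x - b‖ ^ 2 - ‖x - a‖ ^ 2 - ‖a - b‖ ^ 2 := by
  have : x - b = (x - a) + (a - b) := by abel
  rw [this, norm_add_sq_real, real_inner_comm (x - a)]
  ring

/-- The iterates of the optimistic adaptive proximal method on a set `K` in the unit ball, for the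
losses `x ↦ ⟪V, x⟫ + β ‖x‖²` with gradients `V + 2 β x`, in the form of variational inequalities.
The step from `q t` to `q (t + 1)` uses the loss vector `V (t + 1)` that is observed at `p t`,
whereas the prediction `p t` uses the previous loss vector `V t`. -/
structure ProxRun (K : Set E) (β B : ℝ) (V q p : ℕ → E) (l : ℕ → ℝ) : Prop where
  norm_le : ∀ x ∈ K, ‖x‖ ≤ 1
  β_nonneg : 0 ≤ β
  β_le : β ≤ 1
  V_le : ∀ t, ‖V t‖ ≤ B
  q_mem : ∀ t, q t ∈ K
  p_mem : ∀ t, p t ∈ K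
  one_le : ∀ t, 1 ≤ l t
  sq_succ : ∀ t, l (t + 1) ^ 2 = l t ^ 2 + ‖V (t + 1) - V t‖ ^ 2
  step : ∀ t, ∀ x ∈ K, 0 ≤ ⟪V (t + 1) + (2 * β) • q t + (2 * l t) • (q (t + 1) - q t)
    + (2 * (l (t + 1) - l t)) • (q (t + 1) - q 0), x - q (t + 1)⟫
  half : ∀ t, ∀ x ∈ K, 0 ≤ ⟪V t + (2 * β) • q t + (2 * l t) • (p t - q t), x - p t⟫

namespace ProxRun

variable {K : Set E} {β B : ℝ} {V q p : ℕ → E} {l : ℕ → ℝ}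

theorem mono (R : ProxRun K β B V q p l) (t : ℕ) : l t ≤ l (t + 1) := by
  have h1 := R.sq_succ t
  have h2 := R.one_le t
  have h3 := R.one_le (t + 1)
  refine (pow_le_pow_iff_left₀ (by linarith) (by linarith) two_ne_zero).1 ?_
  linarith [sq_nonneg ‖V (t + 1) - V t‖]

theorem le_add (R : ProxRun K β B V q p l) (t : ℕ) : l (t + 1) ≤ l t + ‖V (t + 1) - V t‖ := by
  have h1 := R.sq_succ t
  have h2 := R.one_le t
  have h3 := R.one_le (t + 1)
  have h4 := norm_nonneg (V (t + 1) - V t)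
  refine (pow_le_pow_iff_left₀ (by linarith) (by linarith) two_ne_zero).1 ?_
  rw [h1, add_sq]
  have := mul_nonneg (zero_le_one.trans h2) h4
  linarith

theorem norm_V_sub_le (R : ProxRun K β B V q p l) (t : ℕ) : ‖V (t + 1) - V t‖ ≤ 2 * B :=
  (norm_sub_le _ _).trans (by linarith [R.V_le t, R.V_le (t + 1)])

theorem norm_sub_le_two (R : ProxRun K β B V q p l) {x y : E} (hx : x ∈ K) (hy : y ∈ K) :
    ‖x - y‖ ≤ 2 :=
  (norm_sub_le _ _).trans (by linarith [R.norm_le x hx, R.norm_le y hy])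

/-- The prediction `p t` and the next iterate `q (t + 1)` are proximal steps from the same point,
so they differ by no more than the loss vectors do. -/
theorem norm_p_sub_q_le (R : ProxRun K β B V q p l) (t : ℕ) :
    ‖p t - q (t + 1)‖ ≤ 3 * ‖V (t + 1) - V t‖ := by
  have h1 := R.step t (p t) (R.p_mem t)
  have h2 := R.half t (q (t + 1)) (R.q_mem (t + 1))
  have hw := R.le_add t
  have hm := R.mono t
  have h0 := R.one_le t
  have h3 := R.norm_sub_le_two (R.q_mem (t + 1)) (R.q_mem 0)
  generalize V (t + 1) = V' at *
  generalize q (t + 1) = q' at *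
  generalize l (t + 1) = l' at *
  have e : ⟪V' + (2 * β) • q t + (2 * l t) • (q' - q t) + (2 * (l' - l t)) • (q' - q 0), p t - q'⟫
      + ⟪V t + (2 * β) • q t + (2 * l t) • (p t - q t), q' - p t⟫
      = ⟪V' - V t, p t - q'⟫ + 2 * (l' - l t) * ⟪q' - q 0, p t - q'⟫
        - 2 * l t * ‖p t - q'‖ ^ 2 := by
    rw [← real_inner_self_eq_norm_sq]
    simp only [inner_add_left, inner_sub_left, inner_sub_right, real_inner_smul_left]
    ring
  have c1 : ⟪V' - V t, p t - q'⟫ ≤ ‖V' - V t‖ * ‖p t - q'‖ := real_inner_le_norm _ _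
  have c2 : ⟪q' - q 0, p t - q'⟫ ≤ 2 * ‖p t - q'‖ :=
    (real_inner_le_norm _ _).trans (mul_le_mul_of_nonneg_right h3 (norm_nonneg _))
  have c3 : (l' - l t) * ⟪q' - q 0, p t - q'⟫ ≤ ‖V' - V t‖ * (2 * ‖p t - q'‖) :=
    (mul_le_mul_of_nonneg_left c2 (by linarith)).trans
      (mul_le_mul_of_nonneg_right (by linarith) (by positivity))
  have c4 : ‖p t - q'‖ ^ 2 ≤ l t * ‖p t - q'‖ ^ 2 := le_mul_of_one_le_left (sq_nonneg _) h0
  rcases (norm_nonneg (p t - q')).eq_or_lt with hz | hz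
  · rw [← hz]; positivity
  · refine le_of_mul_le_mul_right ?_ hz
    have := mul_nonneg (norm_nonneg (V' - V t)) hz.le
    linarith [pow_two ‖p t - q'‖]

/-- The regret against a fixed point of `K` is bounded by the final inverse stepsize. -/
theorem regret_le (R : ProxRun K β B V q p l) {x : E} (hx : x ∈ K) (N : ℕ) :
    ∑ t ∈ Finset.range N, (⟪V (t + 1), p t - x⟫ + β * (‖p t‖ ^ 2 - ‖x‖ ^ 2))
      ≤ (5 + B) * l N := by
  have hB : 0 ≤ B := (norm_nonneg _).trans (R.V_le 0)
  have key : ∀ t, ⟪V (t + 1), p t - x⟫ + β * (‖p t‖ ^ 2 - ‖x‖ ^ 2)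
      ≤ l t * ‖x - q t‖ ^ 2 - l (t + 1) * ‖x - q (t + 1)‖ ^ 2 + (5 + B) * (l (t + 1) - l t) := by
    intro t
    have h1 := R.step t x hx
    have h2 := R.half t (q (t + 1)) (R.q_mem (t + 1))
    have h3 := R.norm_sub_le_two hx (R.q_mem 0)
    have hw := R.le_add t
    have hm := R.mono t
    have h0 := R.one_le t
    have hwB := R.norm_V_sub_le t
    have hsq := R.sq_succ t
    have hβ := R.β_le
    have hβ0 := R.β_nonneg
    generalize V (t + 1) = V' at *
    generalize q (t + 1) = q' at *
    generalize l (t + 1) = l' at *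
    simp only [inner_add_left, real_inner_smul_left, mul_assoc,
      mul_left_comm (2 : ℝ) _ (⟪_, _⟫ : ℝ), two_mul_inner_sub_sub] at h1 h2
    have e1 : β * (‖p t‖ ^ 2 - ‖x‖ ^ 2) = 2 * (β * ⟪q t, p t - x⟫)
        + β * ‖p t - q t‖ ^ 2 - β * ‖x - q t‖ ^ 2 := by
      rw [norm_sub_sq_real, norm_sub_sq_real, inner_sub_right, real_inner_comm (q t) (p t),
        real_inner_comm (q t) x]
      ring
    have c1 : ⟪V' - V t, p t - q'⟫ ≤ ‖V' - V t‖ * ‖p t - q'‖ := real_inner_le_norm _ _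
    have e2 : ⟪V', p t - x⟫ = -⟪V', x - q'⟫ - ⟪V t, q' - p t⟫ + ⟪V' - V t, p t - q'⟫ := by
      simp only [inner_sub_left, inner_sub_right]; ring
    have e3 : β * ⟪q t, p t - x⟫ = -(β * ⟪q t, x - q'⟫) - β * ⟪q t, q' - p t⟫ := by
      simp only [inner_sub_right]; ring
    have c2 : β * ‖p t - q t‖ ^ 2 ≤ l t * ‖p t - q t‖ ^ 2 :=
      mul_le_mul_of_nonneg_right (by linarith) (sq_nonneg _)
    have c3 : 0 ≤ β * ‖x - q t‖ ^ 2 := by positivity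
    have c4 : (l' - l t) * ‖x - q 0‖ ^ 2 ≤ (l' - l t) * 4 := by
      refine mul_le_mul_of_nonneg_left ?_ (by linarith)
      have := pow_le_pow_left₀ (norm_nonneg _) h3 2
      linarith
    have c5 : 0 ≤ (l' - l t) * ‖q' - q 0‖ ^ 2 := mul_nonneg (by linarith) (sq_nonneg _)
    -- by Young's inequality the prediction error costs `‖V' - V‖² / (4 l)`, and
    -- `‖V' - V‖² = l'² - l²` makes this telescope
    have c6 : ‖V' - V t‖ * ‖p t - q'‖ ≤ l t * ‖q' - p t‖ ^ 2 + (1 + B) * (l' - l t) := by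
      rw [norm_sub_rev q']
      have hl : 0 < l t := by linarith
      have d1 : ‖V' - V t‖ ^ 2 ≤ 4 * l t * ((1 + B) * (l' - l t)) := by
        have f1 : ‖V' - V t‖ ^ 2 = (l' + l t) * (l' - l t) := by linarith [sq_sub_sq l' (l t)]
        have f2 : l' + l t ≤ l t * (2 + 2 * B) := by
          have := le_mul_of_one_le_left hB h0
          linarith
        have f3 : 0 ≤ l t * ((1 + B) * (l' - l t)) :=
          mul_nonneg hl.le (mul_nonneg (by linarith) (by linarith))
        rw [f1]
        refine (mul_le_mul_of_nonneg_right f2 (by linarith)).trans ?_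
        linarith
      refine le_of_mul_le_mul_left ?_ (show 0 < 4 * l t by linarith)
      have d2 := sq_nonneg (‖V' - V t‖ - 2 * l t * ‖p t - q'‖)
      linarith [sub_sq ‖V' - V t‖ (2 * l t * ‖p t - q'‖), mul_pow (2 * l t) ‖p t - q'‖ 2,
        mul_pow 2 (l t) 2, pow_two (l t)]
    linarith
  have hsum := Finset.sum_le_sum fun t (_ : t ∈ Finset.range N) => key t
  refine hsum.trans ?_
  rw [Finset.sum_add_distrib, ← Finset.mul_sum, Finset.sum_range_sub l,
    Finset.sum_range_sub' (fun t => l t * ‖x - q t‖ ^ 2)]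
  have h3 := R.norm_sub_le_two hx (R.q_mem 0)
  have d1 : l 0 * ‖x - q 0‖ ^ 2 ≤ l 0 * 4 := by
    refine mul_le_mul_of_nonneg_left ?_ (by linarith [R.one_le 0])
    have := pow_le_pow_left₀ (norm_nonneg _) h3 2
    linarith
  have d2 : 0 ≤ l N * ‖x - q N‖ ^ 2 := mul_nonneg (by linarith [R.one_le N]) (sq_nonneg _)
  have d3 : 0 ≤ (1 + B) * l 0 := mul_nonneg (by linarith) (by linarith [R.one_le 0])
  linarith

end ProxRun
end ProxRun

/-! ### Variation of the values along a proximal recursion -/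

section Value

variable {E : Type*} [NormedAddCommGroup E] [InnerProductSpace ℝ E]

open scoped RealInnerProductSpace

/-- The linear loss `v` plus `β` times the Euclidean regularizer. -/
def regLoss (β : ℝ) (v x : E) : ℝ := ⟪v, x⟫ + β * ‖x‖ ^ 2

theorem abs_regLoss_sub_left_le {β : ℝ} (v v' : E) {x : E} (hx : ‖x‖ ≤ 1) :
    |regLoss β v x - regLoss β v' x| ≤ ‖v - v'‖ := by
  have : regLoss β v x - regLoss β v' x = ⟪v - v', x⟫ := by
    simp only [regLoss, inner_sub_left]; ring
  rw [this]
  exact (abs_real_inner_le_norm _ _).trans (mul_le_of_le_one_right (norm_nonneg _) hx)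

theorem abs_regLoss_sub_right_le {β B : ℝ} (h0 : 0 ≤ β) (h1 : β ≤ 1) {v x y : E} (hv : ‖v‖ ≤ B)
    (hx : ‖x‖ ≤ 1) (hy : ‖y‖ ≤ 1) : |regLoss β v x - regLoss β v y| ≤ (B + 2) * ‖x - y‖ := by
  have e : regLoss β v x - regLoss β v y = ⟪v, x - y⟫ + β * ⟪x + y, x - y⟫ := by
    simp only [regLoss, inner_sub_right, inner_add_left, ← real_inner_self_eq_norm_sq,
      real_inner_comm x y]
    ring
  have a1 : |⟪v, x - y⟫| ≤ B * ‖x - y‖ :=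
    (abs_real_inner_le_norm _ _).trans (mul_le_mul_of_nonneg_right hv (norm_nonneg _))
  have a2 : |⟪x + y, x - y⟫| ≤ 2 * ‖x - y‖ :=
    (abs_real_inner_le_norm _ _).trans
      (mul_le_mul_of_nonneg_right ((norm_add_le _ _).trans (by linarith)) (norm_nonneg _))
  have a3 : |β * ⟪x + y, x - y⟫| ≤ 1 * (2 * ‖x - y‖) := by
    rw [abs_mul, abs_of_nonneg h0]
    exact mul_le_mul h1 a2 (abs_nonneg _) zero_le_one
  rw [e]
  exact (abs_add_le _ _).trans (by linarith)

theorem abs_regLoss_le {β B : ℝ} (h0 : 0 ≤ β) (h1 : β ≤ 1) {v x : E} (hv : ‖v‖ ≤ B)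
    (hx : ‖x‖ ≤ 1) : |regLoss β v x| ≤ B + 2 := by
  have h := abs_regLoss_sub_right_le h0 h1 hv hx (y := 0) (by simp)
  have hB : 0 ≤ B := (norm_nonneg _).trans hv
  have e : regLoss β v (0 : E) = 0 := by simp [regLoss]
  rw [e, sub_zero, sub_zero] at h
  exact h.trans (mul_le_of_le_one_right (by linarith) hx)

namespace ProxRun

variable {K : Set E} {β B : ℝ} {V q p : ℕ → E} {l : ℕ → ℝ}

/-- The suboptimality of `q (t + 1)` for the loss from which it was computed. -/
noncomputable def gap (K : Set E) (β : ℝ) (V q : ℕ → E) (t : ℕ) : ℝ :=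
  regLoss β (V (t + 1)) (q (t + 1)) - sInf (regLoss β (V (t + 1)) '' K)

theorem bddBelow (R : ProxRun K β B V q p l) (t : ℕ) : BddBelow (regLoss β (V t) '' K) := by
  refine ⟨-(B + 2), ?_⟩
  rintro _ ⟨x, hx, rfl⟩
  exact (abs_le.1 (abs_regLoss_le R.β_nonneg R.β_le (R.V_le t) (R.norm_le x hx))).1

theorem gap_nonneg (R : ProxRun K β B V q p l) (t : ℕ) : 0 ≤ gap K β V q t :=
  sub_nonneg.2 (csInf_le (R.bddBelow _) ⟨_, R.q_mem _, rfl⟩)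

/-- The minimal loss over `K` is `1`-Lipschitz in the loss vector. -/
theorem sInf_sub_le (R : ProxRun K β B V q p l) (t : ℕ) :
    sInf (regLoss β (V t) '' K) - ‖V (t + 1) - V t‖ ≤ sInf (regLoss β (V (t + 1)) '' K) := by
  refine le_csInf ⟨_, _, R.q_mem 0, rfl⟩ ?_
  rintro _ ⟨x, hx, rfl⟩
  have h1 := csInf_le (R.bddBelow t) ⟨x, hx, rfl⟩
  have h2 := (abs_le.1 (abs_regLoss_sub_left_le (β := β) (V (t + 1)) (V t) (R.norm_le x hx))).1
  linarith

/-- The optimality condition bounds the gap by the length of the step. -/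
theorem gap_le (R : ProxRun K β B V q p l) (t : ℕ) :
    gap K β V q t ≤ 8 * (l t * ‖q (t + 1) - q t‖ + ‖V (t + 1) - V t‖) := by
  suffices h : regLoss β (V (t + 1)) (q (t + 1))
      - 8 * (l t * ‖q (t + 1) - q t‖ + ‖V (t + 1) - V t‖) ≤ sInf (regLoss β (V (t + 1)) '' K) by
    unfold gap; linarith
  refine le_csInf ⟨_, _, R.q_mem 0, rfl⟩ ?_
  rintro _ ⟨x, hx, rfl⟩
  have h1 := R.step t x hx
  have h2 := R.norm_sub_le_two hx (R.q_mem (t + 1))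
  have h3 := R.norm_sub_le_two (R.q_mem (t + 1)) (R.q_mem 0)
  have hw := R.le_add t
  have hm := R.mono t
  have h0 := R.one_le t
  have hβ := R.β_le
  have hβ0 := R.β_nonneg
  generalize V (t + 1) = V' at *
  generalize q (t + 1) = q' at *
  generalize l (t + 1) = l' at *
  simp only [inner_add_left, real_inner_smul_left] at h1
  have e : regLoss β V' x - regLoss β V' q' = ⟪V', x - q'⟫ + 2 * β * ⟪q t, x - q'⟫
      + 2 * β * ⟪q' - q t, x - q'⟫ + β * ‖x - q'‖ ^ 2 := by
    simp only [regLoss, inner_sub_right, inner_sub_left, ← real_inner_self_eq_norm_sq,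
      real_inner_comm x q']
    ring
  have b1 : |⟪q' - q t, x - q'⟫| ≤ ‖q' - q t‖ * 2 :=
    (abs_real_inner_le_norm _ _).trans (mul_le_mul_of_nonneg_left h2 (norm_nonneg _))
  have b2 : |⟪q' - q 0, x - q'⟫| ≤ 2 * 2 :=
    (abs_real_inner_le_norm _ _).trans (mul_le_mul h3 h2 (norm_nonneg _) (by norm_num))
  have c1 : l t * ⟪q' - q t, x - q'⟫ ≤ l t * (‖q' - q t‖ * 2) :=
    mul_le_mul_of_nonneg_left (le_of_abs_le b1) (by linarith)
  have c2 : (l' - l t) * ⟪q' - q 0, x - q'⟫ ≤ ‖V' - V t‖ * (2 * 2) :=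
    (mul_le_mul_of_nonneg_left (le_of_abs_le b2) (by linarith)).trans
      (mul_le_mul_of_nonneg_right (by linarith) (by norm_num))
  have c3 : -(l t * (‖q' - q t‖ * 2)) ≤ β * ⟪q' - q t, x - q'⟫ := by
    have : β * (‖q' - q t‖ * 2) ≤ l t * (‖q' - q t‖ * 2) :=
      mul_le_mul_of_nonneg_right (by linarith) (by positivity)
    have := mul_le_mul_of_nonneg_left (neg_le_of_abs_le b1) hβ0
    linarith
  have c4 : 0 ≤ β * ‖x - q'‖ ^ 2 := by positivity
  linarith

/-- A step of length `u` decreases the loss at least by about `l u²`. -/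
theorem regLoss_sub_succ_ge (R : ProxRun K β B V q p l) (t : ℕ) :
    l t * ‖q (t + 1) - q t‖ ^ 2 - 8 * ‖V (t + 1) - V t‖
      ≤ regLoss β (V (t + 1)) (q t) - regLoss β (V (t + 1)) (q (t + 1)) := by
  have h1 := R.step t (q t) (R.q_mem t)
  have h2 := R.norm_sub_le_two (R.q_mem t) (R.q_mem (t + 1))
  have h3 := R.norm_sub_le_two (R.q_mem (t + 1)) (R.q_mem 0)
  have hw := R.le_add t
  have hm := R.mono t
  have h0 := R.one_le t
  have hβ := R.β_le
  have hβ0 := R.β_nonneg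
  generalize V (t + 1) = V' at *
  generalize q (t + 1) = q' at *
  generalize l (t + 1) = l' at *
  simp only [inner_add_left, real_inner_smul_left] at h1
  have e0 : ⟪q' - q t, q t - q'⟫ = -‖q' - q t‖ ^ 2 := by
    rw [← neg_sub q' (q t), inner_neg_right, real_inner_self_eq_norm_sq]
  have e : regLoss β V' (q t) - regLoss β V' q' = ⟪V', q t - q'⟫ + 2 * β * ⟪q t, q t - q'⟫
      - β * ‖q' - q t‖ ^ 2 := by
    simp only [regLoss, inner_sub_right, inner_sub_left, ← real_inner_self_eq_norm_sq,
      real_inner_comm (q t) q']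
    ring
  have b2 : |⟪q' - q 0, q t - q'⟫| ≤ 2 * 2 :=
    (abs_real_inner_le_norm _ _).trans (mul_le_mul h3 h2 (norm_nonneg _) (by norm_num))
  have c2 : (l' - l t) * ⟪q' - q 0, q t - q'⟫ ≤ ‖V' - V t‖ * (2 * 2) :=
    (mul_le_mul_of_nonneg_left (le_of_abs_le b2) (by linarith)).trans
      (mul_le_mul_of_nonneg_right (by linarith) (by norm_num))
  have c3 : β * ‖q' - q t‖ ^ 2 ≤ l t * ‖q' - q t‖ ^ 2 :=
    mul_le_mul_of_nonneg_right (by linarith) (sq_nonneg _)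
  rw [e0] at h1
  linarith

/-- The gap drops by `l u²`, up to the change of the loss. -/
theorem gap_succ_le (R : ProxRun K β B V q p l) (t : ℕ) :
    gap K β V q (t + 1) ≤ gap K β V q t - l (t + 1) * ‖q (t + 2) - q (t + 1)‖ ^ 2
      + 10 * ‖V (t + 2) - V (t + 1)‖ := by
  have h1 := R.regLoss_sub_succ_ge (t + 1)
  have h2 := R.sInf_sub_le (t + 1)
  have h3 := (abs_le.1 (abs_regLoss_sub_left_le (β := β) (V (t + 2)) (V (t + 1))
    (R.norm_le _ (R.q_mem (t + 1))))).2
  unfold gap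
  simp only [add_assoc, Nat.reduceAdd] at *
  linarith

/-- Proximal steps are nonexpansive, so the step lengths grow only through changes of the loss
and of the stepsize. -/
theorem step_length_le (R : ProxRun K β B V q p l) (t : ℕ) :
    l (t + 1) * (‖q (t + 2) - q (t + 1)‖ - ‖q (t + 1) - q t‖)
      ≤ 3 * (‖V (t + 1) - V t‖ + ‖V (t + 2) - V (t + 1)‖) := by
  have h1 := R.step t (q (t + 2)) (R.q_mem _)
  have h2 : 0 ≤ ⟪V (t + 2) + (2 * β) • q (t + 1) + (2 * l (t + 1)) • (q (t + 2) - q (t + 1))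
    + (2 * (l (t + 2) - l (t + 1))) • (q (t + 2) - q 0), q (t + 1) - q (t + 2)⟫ :=
    R.step (t + 1) (q (t + 1)) (R.q_mem _)
  have hw := R.le_add t
  have hw' : l (t + 2) ≤ l (t + 1) + ‖V (t + 2) - V (t + 1)‖ := R.le_add (t + 1)
  have hm := R.mono t
  have hm' : l (t + 1) ≤ l (t + 2) := R.mono (t + 1)
  have h0 := R.one_le t
  have hβ := R.β_le
  have hβ0 := R.β_nonneg
  have k1 := R.norm_le _ (R.q_mem (t + 1))
  have k0 := R.norm_le _ (R.q_mem 0)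
  generalize V (t + 2) = V'' at *
  generalize q (t + 2) = q'' at *
  generalize l (t + 2) = l'' at *
  generalize V (t + 1) = V' at *
  generalize q (t + 1) = q' at *
  generalize l (t + 1) = l' at *
  -- both steps are projections of a point scaled with the respective stepsize; `e` is the
  -- difference of these points, once the change of scale is moved to the side of the projections
  obtain ⟨e, he⟩ : ∃ e : E, e = (l t - β) • (q' - q t) + (2 * l' - l t - l'') • q'
      + (l'' - l' - (l' - l t)) • q 0 - (1 / 2 : ℝ) • (V'' - V') := ⟨_, rfl⟩
  have hin : l'' * ‖q'' - q'‖ ^ 2 ≤ ⟪e, q'' - q'⟫ := by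
    have : ⟪V' + (2 * β) • q t + (2 * l t) • (q' - q t) + (2 * (l' - l t)) • (q' - q 0), q'' - q'⟫
        + ⟪V'' + (2 * β) • q' + (2 * l') • (q'' - q') + (2 * (l'' - l')) • (q'' - q 0), q' - q''⟫
        = 2 * (⟪e, q'' - q'⟫ - l'' * ‖q'' - q'‖ ^ 2) := by
      rw [he, ← real_inner_self_eq_norm_sq]
      simp only [inner_add_left, inner_sub_left, inner_sub_right, real_inner_smul_left]
      ring
    linarith
  have hn : l'' * ‖q'' - q'‖ ≤ ‖e‖ := by
    rcases (norm_nonneg (q'' - q')).eq_or_lt with hz | hz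
    · rw [← hz, mul_zero]; exact norm_nonneg _
    · refine le_of_mul_le_mul_right ?_ hz
      have := real_inner_le_norm e (q'' - q')
      linarith [pow_two ‖q'' - q'‖]
  have he2 : ‖e‖ ≤ l t * ‖q' - q t‖ + 2 * ((l'' - l') + (l' - l t)) + 1 / 2 * ‖V'' - V'‖ := by
    have d1 : ‖(l t - β) • (q' - q t)‖ ≤ l t * ‖q' - q t‖ := by
      rw [norm_smul, Real.norm_of_nonneg (by linarith)]
      exact mul_le_mul_of_nonneg_right (by linarith) (norm_nonneg _)
    have d2 : ‖(2 * l' - l t - l'') • q'‖ ≤ (l'' - l') + (l' - l t) := by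
      rw [norm_smul]
      refine (mul_le_of_le_one_right (norm_nonneg _) k1).trans ?_
      rw [Real.norm_eq_abs, abs_le]
      constructor <;> linarith
    have d3 : ‖(l'' - l' - (l' - l t)) • q 0‖ ≤ (l'' - l') + (l' - l t) := by
      rw [norm_smul]
      refine (mul_le_of_le_one_right (norm_nonneg _) k0).trans ?_
      rw [Real.norm_eq_abs, abs_le]
      constructor <;> linarith
    have d4 : ‖(1 / 2 : ℝ) • (V'' - V')‖ = 1 / 2 * ‖V'' - V'‖ := by
      rw [norm_smul, Real.norm_of_nonneg (by norm_num)]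
    rw [he]
    refine (norm_sub_le _ _).trans ?_
    have d5 := norm_add_le ((l t - β) • (q' - q t) + (2 * l' - l t - l'') • q')
      ((l'' - l' - (l' - l t)) • q 0)
    have d6 := norm_add_le ((l t - β) • (q' - q t)) ((2 * l' - l t - l'') • q')
    linarith
  have f1 : l' * ‖q'' - q'‖ ≤ l'' * ‖q'' - q'‖ :=
    mul_le_mul_of_nonneg_right (by linarith) (norm_nonneg _)
  have f2 : l t * ‖q' - q t‖ ≤ l' * ‖q' - q t‖ :=
    mul_le_mul_of_nonneg_right (by linarith) (norm_nonneg _)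
  have := norm_nonneg (V'' - V')
  have := norm_nonneg (V' - V t)
  linarith

/-- The decrease of the loss in a step is at most of the order of `l u²`: the optimality condition
of the previous step, tested at the next iterate, bounds the linear part. -/
theorem regLoss_sub_succ_le (R : ProxRun K β B V q p l) (t : ℕ) :
    regLoss β (V (t + 2)) (q (t + 1)) - regLoss β (V (t + 2)) (q (t + 2))
      ≤ 2 * (l t * ‖q (t + 1) - q t‖ ^ 2 + l (t + 1) * ‖q (t + 2) - q (t + 1)‖ ^ 2)
        + 8 * (‖V (t + 1) - V t‖ + ‖V (t + 2) - V (t + 1)‖) := by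
  have h1 := R.step t (q (t + 2)) (R.q_mem _)
  have hw := R.le_add t
  have hm := R.mono t
  have h0 := R.one_le t
  have hβ := R.β_le
  have hβ0 := R.β_nonneg
  have k1 := R.norm_sub_le_two (R.q_mem (t + 2)) (R.q_mem (t + 1))
  have k0 := R.norm_sub_le_two (R.q_mem (t + 1)) (R.q_mem 0)
  generalize V (t + 2) = V'' at *
  generalize q (t + 2) = q'' at *
  generalize V (t + 1) = V' at *
  generalize q (t + 1) = q' at *
  generalize l (t + 1) = l' at *
  simp only [inner_add_left, real_inner_smul_left] at h1
  have e : regLoss β V'' q' - regLoss β V'' q'' = -⟪V', q'' - q'⟫ - 2 * β * ⟪q t, q'' - q'⟫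
      - ⟪V'' - V', q'' - q'⟫ - 2 * β * ⟪q' - q t, q'' - q'⟫ - β * ‖q'' - q'‖ ^ 2 := by
    simp only [regLoss, inner_sub_right, inner_sub_left, ← real_inner_self_eq_norm_sq,
      real_inner_comm q' q'']
    ring
  have a1 : |⟪q' - q t, q'' - q'⟫| ≤ (‖q' - q t‖ ^ 2 + ‖q'' - q'‖ ^ 2) / 2 :=
    (abs_real_inner_le_norm _ _).trans
      (by linarith [sq_nonneg (‖q' - q t‖ - ‖q'' - q'‖), sub_sq ‖q' - q t‖ ‖q'' - q'‖])
  have a2 : |⟪V'' - V', q'' - q'⟫| ≤ ‖V'' - V'‖ * 2 :=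
    (abs_real_inner_le_norm _ _).trans (mul_le_mul_of_nonneg_left k1 (norm_nonneg _))
  have a3 : |⟪q' - q 0, q'' - q'⟫| ≤ 2 * 2 :=
    (abs_real_inner_le_norm _ _).trans (mul_le_mul k0 k1 (norm_nonneg _) (by norm_num))
  have c1 : l t * ⟪q' - q t, q'' - q'⟫ ≤ l t * ((‖q' - q t‖ ^ 2 + ‖q'' - q'‖ ^ 2) / 2) :=
    mul_le_mul_of_nonneg_left (le_of_abs_le a1) (by linarith)
  have c2 : (l' - l t) * ⟪q' - q 0, q'' - q'⟫ ≤ ‖V' - V t‖ * (2 * 2) :=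
    (mul_le_mul_of_nonneg_left (le_of_abs_le a3) (by linarith)).trans
      (mul_le_mul_of_nonneg_right (by linarith) (by norm_num))
  have c3 := mul_le_mul_of_nonneg_left (neg_le_of_abs_le a1) hβ0
  have c4 : β * ((‖q' - q t‖ ^ 2 + ‖q'' - q'‖ ^ 2) / 2)
      ≤ l t * ((‖q' - q t‖ ^ 2 + ‖q'' - q'‖ ^ 2) / 2) :=
    mul_le_mul_of_nonneg_right (by linarith) (by positivity)
  have c5 : l t * ‖q'' - q'‖ ^ 2 ≤ l' * ‖q'' - q'‖ ^ 2 :=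
    mul_le_mul_of_nonneg_right (by linarith) (sq_nonneg _)
  have c6 : 0 ≤ β * ‖q'' - q'‖ ^ 2 := by positivity
  have c7 := neg_le_of_abs_le a2
  have := norm_nonneg (V'' - V')
  have := norm_nonneg (V' - V t)
  linarith

/-- The value of the iterates varies by no more than the losses do and the squared steps. -/
theorem abs_value_sub_le (R : ProxRun K β B V q p l) (t : ℕ) :
    |regLoss β (V (t + 2)) (p (t + 1)) - regLoss β (V (t + 1)) (p t)|
      ≤ (3 * B + 17) * ((‖V (t + 1) - V t‖ + ‖V (t + 2) - V (t + 1)‖)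
        + (l t * ‖q (t + 1) - q t‖ ^ 2 + l (t + 1) * ‖q (t + 2) - q (t + 1)‖ ^ 2)) := by
  have hB : 0 ≤ B := (norm_nonneg _).trans (R.V_le 0)
  have a1 := R.norm_p_sub_q_le t
  have a2 := R.norm_p_sub_q_le (t + 1)
  have b1 := (abs_regLoss_sub_right_le R.β_nonneg R.β_le (R.V_le (t + 1)) (R.norm_le _ (R.p_mem t))
    (R.norm_le _ (R.q_mem (t + 1)))).trans (mul_le_mul_of_nonneg_left a1 (by linarith))
  have b2 := (abs_regLoss_sub_right_le R.β_nonneg R.β_le (R.V_le (t + 2))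
    (R.norm_le _ (R.p_mem (t + 1)))
    (R.norm_le _ (R.q_mem (t + 2)))).trans (mul_le_mul_of_nonneg_left a2 (by linarith))
  have b3 := abs_regLoss_sub_left_le (β := β) (V (t + 2)) (V (t + 1))
    (R.norm_le _ (R.q_mem (t + 1)))
  have c1 := R.regLoss_sub_succ_ge (t + 1)
  have c2 := R.regLoss_sub_succ_le t
  simp only [add_assoc, Nat.reduceAdd] at *
  have x0 : 0 ≤ l t * ‖q (t + 1) - q t‖ ^ 2 :=
    mul_nonneg (by linarith [R.one_le t]) (sq_nonneg _)
  have x1 : 0 ≤ l (t + 1) * ‖q (t + 2) - q (t + 1)‖ ^ 2 :=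
    mul_nonneg (by linarith [R.one_le (t + 1)]) (sq_nonneg _)
  have w0 := norm_nonneg (V (t + 1) - V t)
  have w1 := norm_nonneg (V (t + 2) - V (t + 1))
  have y0 := mul_nonneg hB x0
  have y1 := mul_nonneg hB x1
  have z0 := mul_nonneg hB w0
  have z1 := mul_nonneg hB w1
  rw [abs_le] at *
  constructor <;> linarith

/-- The squared variations of the values sum to no more than the squared variations of the
losses, up to constants. -/
theorem sum_sq_value_sub_le (B L : ℝ) (hL : 1 ≤ L) :
    ∃ C : ℝ, 0 ≤ C ∧ ∀ (K : Set E) (β : ℝ) (V q p : ℕ → E) (l : ℕ → ℝ),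
      ProxRun K β B V q p l → l 0 ≤ L → ∀ N,
      ∑ t ∈ Finset.range N, (regLoss β (V (t + 2)) (p (t + 1)) - regLoss β (V (t + 1)) (p t)) ^ 2
        ≤ C * (1 + ∑ t ∈ Finset.range (N + 1), ‖V (t + 1) - V t‖ ^ 2) := by
  obtain ⟨C, hC0, hC⟩ := sum_sq_energy_le (10 + 2 * |B|) L (by linarith [abs_nonneg B]) hL
  refine ⟨8 * (3 * |B| + 17) ^ 2 * (1 + C), by positivity, ?_⟩
  intro K β V q p l R hl0 N
  have hB : 0 ≤ B := (norm_nonneg _).trans (R.V_le 0)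
  rw [abs_of_nonneg hB] at *
  have hE := hC (fun t => ‖q (t + 1) - q t‖) (gap K β V q) l (fun t => ‖V (t + 1) - V t‖)
    (fun t => norm_nonneg _) (fun t => R.norm_sub_le_two (R.q_mem _) (R.q_mem _)) R.gap_nonneg
    (fun t => norm_nonneg _) (fun t => (R.norm_V_sub_le t).trans (by linarith)) R.one_le hl0 R.mono
    R.le_add
    (fun t => (R.gap_succ_le t).trans (by
      have := mul_nonneg hB (norm_nonneg (V (t + 2) - V (t + 1)))
      simp only [add_assoc, Nat.reduceAdd]
      linarith))
    (fun t => (R.gap_le t).trans (mul_le_mul_of_nonneg_right (by linarith)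
      (add_nonneg (mul_nonneg (by linarith [R.one_le t]) (norm_nonneg _)) (norm_nonneg _))))
    (fun t => (R.step_length_le t).trans
      (mul_le_mul_of_nonneg_right (by linarith) (add_nonneg (norm_nonneg _) (norm_nonneg _))))
    (N + 1)
  obtain ⟨w, hw⟩ : ∃ w : ℕ → ℝ, ∀ t, ‖V (t + 1) - V t‖ = w t := ⟨_, fun _ => rfl⟩
  obtain ⟨X, hX⟩ : ∃ X : ℕ → ℝ, ∀ t, l t * ‖q (t + 1) - q t‖ ^ 2 = X t := ⟨_, fun _ => rfl⟩
  simp only [hw, hX] at hE ⊢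
  have hpt : ∀ t, (regLoss β (V (t + 2)) (p (t + 1)) - regLoss β (V (t + 1)) (p t)) ^ 2
      ≤ 4 * (3 * B + 17) ^ 2 * ((w t ^ 2 + w (t + 1) ^ 2) + (X t ^ 2 + X (t + 1) ^ 2)) := by
    intro t
    have h := R.abs_value_sub_le t
    have e1 := hw (t + 1)
    have e2 := hX (t + 1)
    simp only [add_assoc, Nat.reduceAdd] at e1 e2
    rw [hw, hX, e1, e2] at h
    rw [← sq_abs]
    refine (pow_le_pow_left₀ (abs_nonneg _) h 2).trans ?_
    rw [mul_pow, mul_comm (4 : ℝ), mul_assoc]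
    refine mul_le_mul_of_nonneg_left ?_ (sq_nonneg _)
    generalize w t = a
    generalize w (t + 1) = b
    generalize X t = c
    generalize X (t + 1) = d
    nlinarith [sq_nonneg (a - b), sq_nonneg (c - d), sq_nonneg (a - c), sq_nonneg (a - d),
      sq_nonneg (b - c), sq_nonneg (b - d)]
  refine (Finset.sum_le_sum fun t _ => hpt t).trans ?_
  have shift : ∀ f : ℕ → ℝ, (∀ t, 0 ≤ f t) →
      ∑ t ∈ Finset.range N, (f t + f (t + 1)) ≤ 2 * ∑ t ∈ Finset.range (N + 1), f t := by
    intro f hf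
    rw [Finset.sum_add_distrib, two_mul]
    refine add_le_add ?_ ?_
    · rw [Finset.sum_range_succ]; linarith [hf N]
    · rw [Finset.sum_range_succ' f]; linarith [hf 0]
  have s1 := shift (fun t => w t ^ 2) (fun _ => sq_nonneg _)
  have s2 := shift (fun t => X t ^ 2) (fun _ => sq_nonneg _)
  rw [← Finset.mul_sum, Finset.sum_add_distrib, mul_comm (8 : ℝ), mul_comm (4 : ℝ), mul_assoc,
    mul_assoc, mul_assoc]
  refine mul_le_mul_of_nonneg_left ?_ (sq_nonneg _)
  linarith

end ProxRun
end Value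

/-! ### Sequence form and behavioral form -/

namespace Treeplex

section SequenceForm

variable {H I : Type} (Z : Treeplex H I)

/-- The recursion that defines the sequence form, for a general index. -/
theorem toSeq_eq (q : I → ℝ) (i : I) :
    Z.toSeq q i = q i * Z.parentMass (Z.toSeq q) (Z.infoset i) := by
  induction Z with
  | simplex n => simp [toSeq, parentMass, parent]
  | prod Z₁ Z₂ ih₁ ih₂ =>
    rcases i with i | i
    · have := ih₁ (q ∘ Sum.inl) i
      simp only [toSeq, parentMass, parent, infoset, Sum.elim_inl, Sum.map_inl] at this ⊢
      rw [this]
      cases Z₁.parent (Z₁.infoset i) <;> simp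
    · have := ih₂ (q ∘ Sum.inr) i
      simp only [toSeq, parentMass, parent, infoset, Sum.elim_inr, Sum.map_inr] at this ⊢
      rw [this]
      cases Z₂.parent (Z₂.infoset i) <;> simp
  | branch Z₁ k Z₂ ih₁ ih₂ =>
    rcases i with i | i
    · have := ih₁ (q ∘ Sum.inl) i
      simp only [toSeq, parentMass, parent, infoset, Sum.elim_inl, Sum.map_inl] at this ⊢
      rw [this]
      cases Z₁.parent (Z₁.infoset i) <;> simp
    · have := ih₂ (q ∘ Sum.inr) i
      simp only [toSeq, parentMass, parent, infoset, Sum.elim_inr, Sum.map_inr, Pi.smul_apply,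
        smul_eq_mul] at this ⊢
      rw [this]
      cases Z₂.parent (Z₂.infoset i)
      · simp [mul_comm]
      · simp only [Option.elim_some, Sum.elim_inr, Function.comp_apply, Pi.smul_apply, smul_eq_mul]
        ring

/-- Induction along the tree, from the roots downwards. -/
theorem index_induction {P : I → Prop}
    (step : ∀ i, (∀ j, Z.parent (Z.infoset i) = some j → P j) → P i) (i : I) : P i := by
  have aux : ∀ n, ∀ i, Z.size - Z.height (Z.infoset i) ≤ n → P i := by
    intro n
    induction n with
    | zero =>
      intro i hi
      have := Z.height_lt_size (Z.infoset i)
      omega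
    | succ n ih =>
      intro i hi
      refine step i fun j hj => ih j ?_
      have := Z.height_lt hj
      have := Z.height_lt_size (Z.infoset j)
      omega
  exact aux _ i le_rfl

/-- The recursion of `toSeq_eq` determines the sequence form. -/
theorem eq_toSeq {q z : I → ℝ} (h : ∀ i, z i = q i * Z.parentMass z (Z.infoset i)) :
    z = Z.toSeq q := by
  funext i
  refine Z.index_induction (P := fun i => z i = Z.toSeq q i) (fun i ih => ?_) i
  rw [h i, Z.toSeq_eq]
  congr 1
  unfold parentMass
  cases hp : Z.parent (Z.infoset i) with
  | none => rfl
  | some j => exact ih j hp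

theorem parentMass_mem_Icc {z : I → ℝ} (hz : ∀ i, z i ∈ Set.Icc (0 : ℝ) 1) (h : H) :
    Z.parentMass z h ∈ Set.Icc (0 : ℝ) 1 := by
  unfold parentMass
  cases Z.parent h with
  | none => simp
  | some j => exact hz j

theorem toSeq_mem_Icc {q : I → ℝ} (hq : ∀ i, q i ∈ Set.Icc (0 : ℝ) 1) (i : I) :
    Z.toSeq q i ∈ Set.Icc (0 : ℝ) 1 := by
  refine Z.index_induction (P := fun i => Z.toSeq q i ∈ Set.Icc (0 : ℝ) 1) (fun i ih => ?_) i
  rw [Z.toSeq_eq]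
  have : Z.parentMass (Z.toSeq q) (Z.infoset i) ∈ Set.Icc (0 : ℝ) 1 := by
    unfold parentMass
    cases hp : Z.parent (Z.infoset i) with
    | none => simp
    | some j => exact ih j hp
  exact ⟨mul_nonneg (hq i).1 this.1, mul_le_one₀ (hq i).2 this.1 this.2⟩

theorem continuous_toSeq : Continuous Z.toSeq := by
  refine continuous_pi fun i => ?_
  refine Z.index_induction (P := fun i => Continuous fun q => Z.toSeq q i) (fun i ih => ?_) i
  have : (fun q => Z.toSeq q i)
      = fun q => q i * Z.parentMass (Z.toSeq q) (Z.infoset i) := funext fun q => Z.toSeq_eq q i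
  rw [this]
  refine (continuous_apply i).mul ?_
  unfold parentMass
  cases hp : Z.parent (Z.infoset i) with
  | none => exact continuous_const
  | some j => exact ih j hp

theorem continuous_parentMass (h : H) : Continuous fun z => Z.parentMass z h := by
  unfold parentMass
  cases hp : Z.parent h with
  | none => exact continuous_const
  | some j => exact continuous_apply j

theorem carrier_nonneg {z : I → ℝ} (hz : z ∈ Z.carrier) (i : I) : 0 ≤ z i := by
  induction Z with
  | simplex n => exact hz.1 i
  | prod Z₁ Z₂ ih₁ ih₂ =>
    obtain ⟨u, hu, v, hv, rfl⟩ := hz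
    rcases i with i | i
    · exact ih₁ hu i
    · exact ih₂ hv i
  | branch Z₁ k Z₂ ih₁ ih₂ =>
    obtain ⟨u, hu, v, hv, rfl⟩ := hz
    rcases i with i | i
    · exact ih₁ hu i
    · exact mul_nonneg (ih₁ hu k) (ih₂ hv i)

/-- Conservation of mass at an information set.  The set `s` of its indices is given as a finset,
so that the induction over the treeplex needs no instances on the index types. -/
theorem carrier_sum {z : I → ℝ} (hz : z ∈ Z.carrier) (h : H) (s : Finset I)
    (hs : ∀ i, i ∈ s ↔ Z.infoset i = h) : ∑ i ∈ s, z i = Z.parentMass z h := by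
  induction Z with
  | simplex n =>
    have : s = Finset.univ := Finset.eq_univ_of_forall fun i => (hs i).2 rfl
    rw [this]
    exact hz.2
  | prod Z₁ Z₂ ih₁ ih₂ =>
    obtain ⟨u, hu, v, hv, rfl⟩ := hz
    rw [← Finset.toLeft_disjSum_toRight (u := s), Finset.sum_disjSum]
    simp only [Sum.elim_inl, Sum.elim_inr]
    rcases h with h | h
    · have e : s.toRight = ∅ := Finset.eq_empty_of_forall_notMem fun i hi => by
        have := (hs _).1 (Finset.mem_toRight.1 hi)
        simp [infoset] at this
      rw [e, Finset.sum_empty, add_zero, ih₁ hu h s.toLeft fun i => by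
        rw [Finset.mem_toLeft, hs]; simp [infoset]]
      simp only [parentMass, parent, Sum.elim_inl]
      cases Z₁.parent h <;> simp
    · have e : s.toLeft = ∅ := Finset.eq_empty_of_forall_notMem fun i hi => by
        have := (hs _).1 (Finset.mem_toLeft.1 hi)
        simp [infoset] at this
      rw [e, Finset.sum_empty, zero_add, ih₂ hv h s.toRight fun i => by
        rw [Finset.mem_toRight, hs]; simp [infoset]]
      simp only [parentMass, parent, Sum.elim_inr]
      cases Z₂.parent h <;> simp
  | branch Z₁ k Z₂ ih₁ ih₂ =>
    obtain ⟨u, hu, v, hv, rfl⟩ := hz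
    rw [← Finset.toLeft_disjSum_toRight (u := s), Finset.sum_disjSum]
    simp only [Sum.elim_inl, Sum.elim_inr, Pi.smul_apply, smul_eq_mul, ← Finset.mul_sum]
    rcases h with h | h
    · have e : s.toRight = ∅ := Finset.eq_empty_of_forall_notMem fun i hi => by
        have := (hs _).1 (Finset.mem_toRight.1 hi)
        simp [infoset] at this
      rw [e, Finset.sum_empty, mul_zero, add_zero, ih₁ hu h s.toLeft fun i => by
        rw [Finset.mem_toLeft, hs]; simp [infoset]]
      simp only [parentMass, parent, Sum.elim_inl]
      cases Z₁.parent h <;> simp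
    · have e : s.toLeft = ∅ := Finset.eq_empty_of_forall_notMem fun i hi => by
        have := (hs _).1 (Finset.mem_toLeft.1 hi)
        simp [infoset] at this
      rw [e, Finset.sum_empty, zero_add, ih₂ hv h s.toRight fun i => by
        rw [Finset.mem_toRight, hs]; simp [infoset]]
      simp only [parentMass, parent, Sum.elim_inr]
      cases Z₂.parent h <;> simp

end SequenceForm

section Behavioral

variable {H I : Type} [Fintype H] [DecidableEq H] [Fintype I] [DecidableEq I] (Z : Treeplex H I)

/-- The behavioral strategies of the `γ`-perturbed treeplex. -/
def behavioral (γ : ℝ) : Set (I → ℝ) :=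
  {q | ∀ h, Z.slice q h ∈ perturbedSimplex γ (Z.Act h)}

variable {Z}

theorem mem_Icc_of_mem_behavioral {γ : ℝ} {q : I → ℝ} (hq : q ∈ Z.behavioral γ) (i : I) :
    q i ∈ Set.Icc (0 : ℝ) 1 := by
  have h := (hq (Z.infoset i)).1
  refine ⟨h.1 ⟨i, rfl⟩, ?_⟩
  have := Finset.single_le_sum (f := Z.slice q (Z.infoset i)) (fun j _ => h.1 j)
    (Finset.mem_univ (⟨i, rfl⟩ : Z.Act (Z.infoset i)))
  rw [h.2] at this
  exact this

variable (Z)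

/-- Every point of the perturbed treeplex is the sequence form of a behavioral strategy: at
information sets that are not reached, the strategy `q₀` serves as a default. -/
theorem exists_behavioral {γ : ℝ} {q₀ z : I → ℝ} (hq₀ : q₀ ∈ Z.behavioral γ)
    (hz : z ∈ Z.carrier) (hγ : ∀ i, γ * Z.parentMass z (Z.infoset i) ≤ z i) :
    ∃ q ∈ Z.behavioral γ, Z.toSeq q = z := by
  have h0 : ∀ h, 0 ≤ Z.parentMass z h := by
    intro h
    unfold parentMass
    cases Z.parent h with
    | none => exact zero_le_one
    | some j => exact Z.carrier_nonneg hz j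
  have hsum : ∀ h, ∑ i : Z.Act h, z i.1 = Z.parentMass z h := by
    intro h
    rw [← Z.carrier_sum hz h (Finset.univ.filter fun i => Z.infoset i = h) (by simp)]
    exact (Finset.sum_subtype _ (by simp) z).symm
  refine ⟨fun i => if Z.parentMass z (Z.infoset i) = 0 then q₀ i
    else z i / Z.parentMass z (Z.infoset i), ?_, ?_⟩
  · intro h
    by_cases hm : Z.parentMass z h = 0
    · have : Z.slice (fun i => if Z.parentMass z (Z.infoset i) = 0 then q₀ i
          else z i / Z.parentMass z (Z.infoset i)) h = Z.slice q₀ h := by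
        funext i
        simp only [slice, i.2, hm, if_true]
      rw [this]
      exact hq₀ h
    · have : Z.slice (fun i => if Z.parentMass z (Z.infoset i) = 0 then q₀ i
          else z i / Z.parentMass z (Z.infoset i)) h = fun i => z i.1 / Z.parentMass z h := by
        funext i
        simp only [slice, i.2, hm, if_false]
      rw [this]
      have hpos : 0 < Z.parentMass z h := lt_of_le_of_ne (h0 h) (Ne.symm hm)
      refine ⟨⟨fun i => div_nonneg (Z.carrier_nonneg hz _) (h0 h), ?_⟩, fun i => ?_⟩
      · rw [← Finset.sum_div, hsum, div_self hm]
      · rw [le_div_iff₀ hpos]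
        have := hγ i.1
        rwa [i.2] at this
  · refine (Z.eq_toSeq fun i => ?_).symm
    split_ifs with hm
    · rw [hm, mul_zero]
      have := hsum (Z.infoset i)
      rw [hm] at this
      exact (Finset.sum_eq_zero_iff_of_nonneg fun j _ => Z.carrier_nonneg hz _).1 this
        (⟨i, rfl⟩ : Z.Act (Z.infoset i)) (Finset.mem_univ _)
    · rw [div_mul_cancel₀ _ hm]

/-- The distance of sequence forms is controlled by the distances of the behavioral strategies,
weighted with the reach of one of the two. -/
theorem sum_sq_toSeq_sub_le {q q' : I → ℝ} (hq : ∀ i, q i ∈ Set.Icc (0 : ℝ) 1)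
    (hq' : ∀ i, q' i ∈ Set.Icc (0 : ℝ) 1) :
    ∑ i, (Z.toSeq q i - Z.toSeq q' i) ^ 2 ≤ Fintype.card I * Z.size ^ 2 *
      ∑ h, Z.parentMass (Z.toSeq q) h * ∑ i : Z.Act h, (q i.1 - q' i.1) ^ 2 := by
  set S := ∑ h, Z.parentMass (Z.toSeq q) h * ∑ i : Z.Act h, (q i.1 - q' i.1) ^ 2 with hS
  have hm := Z.parentMass_mem_Icc (Z.toSeq_mem_Icc hq)
  have hterm : ∀ h, 0 ≤ Z.parentMass (Z.toSeq q) h * ∑ i : Z.Act h, (q i.1 - q' i.1) ^ 2 :=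
    fun h => mul_nonneg (hm h).1 (Finset.sum_nonneg fun _ _ => sq_nonneg _)
  have hS0 : 0 ≤ S := Finset.sum_nonneg fun h _ => hterm h
  have hloc : ∀ i, Z.parentMass (Z.toSeq q) (Z.infoset i) * |q i - q' i| ≤ √S := by
    intro i
    refine Real.le_sqrt_of_sq_le ?_
    rw [mul_pow, sq_abs]
    have h1 := Finset.single_le_sum (fun h _ => hterm h) (Finset.mem_univ (Z.infoset i))
    have h2 := Finset.single_le_sum
      (f := fun i : Z.Act (Z.infoset i) => (q i.1 - q' i.1) ^ 2) (fun j _ => sq_nonneg _)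
      (Finset.mem_univ (⟨i, rfl⟩ : Z.Act (Z.infoset i)))
    have h3 := hm (Z.infoset i)
    calc _ ≤ Z.parentMass (Z.toSeq q) (Z.infoset i) * (q i - q' i) ^ 2 :=
          mul_le_mul_of_nonneg_right (by nlinarith [h3.1, h3.2]) (sq_nonneg _)
      _ ≤ _ := mul_le_mul_of_nonneg_left h2 h3.1
      _ ≤ S := h1
  have key : ∀ i, |Z.toSeq q i - Z.toSeq q' i| ≤ (Z.size - Z.height (Z.infoset i) : ℝ) * √S := by
    refine Z.index_induction fun i ih => ?_
    have hsz : (Z.height (Z.infoset i) : ℝ) + 1 ≤ Z.size := by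
      exact_mod_cast Z.height_lt_size (Z.infoset i)
    rw [Z.toSeq_eq q, Z.toSeq_eq q']
    cases hp : Z.parent (Z.infoset i) with
    | none =>
      have h1 := hloc i
      simp only [parentMass, hp, Option.elim_none, one_mul, mul_one] at h1 ⊢
      exact h1.trans (le_mul_of_one_le_left (Real.sqrt_nonneg _) (by linarith))
    | some j =>
      have h1 := hloc i
      have h2 := ih j hp
      have h3 : (Z.height (Z.infoset i) : ℝ) + 1 ≤ Z.height (Z.infoset j) := by
        exact_mod_cast Z.height_lt hp
      simp only [parentMass, hp, Option.elim_some] at h1 ⊢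
      have e : q i * Z.toSeq q j - q' i * Z.toSeq q' j
          = Z.toSeq q j * (q i - q' i) + q' i * (Z.toSeq q j - Z.toSeq q' j) := by ring
      rw [e]
      refine (abs_add_le _ _).trans ?_
      rw [abs_mul, abs_mul, abs_of_nonneg (Z.toSeq_mem_Icc hq j).1, abs_of_nonneg (hq' i).1]
      have h4 : q' i * |Z.toSeq q j - Z.toSeq q' j| ≤ |Z.toSeq q j - Z.toSeq q' j| :=
        mul_le_of_le_one_left (abs_nonneg _) (hq' i).2
      have h5 : (Z.size - Z.height (Z.infoset j) + 1 : ℝ) * √S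
          ≤ (Z.size - Z.height (Z.infoset i) : ℝ) * √S :=
        mul_le_mul_of_nonneg_right (by linarith) (Real.sqrt_nonneg _)
      linarith
  have hpt : ∀ i ∈ Finset.univ, (Z.toSeq q i - Z.toSeq q' i) ^ 2 ≤ (Z.size : ℝ) ^ 2 * S := by
    intro i _
    have h1 : |Z.toSeq q i - Z.toSeq q' i| ≤ Z.size * √S :=
      (key i).trans (mul_le_mul_of_nonneg_right
        (by linarith [(Nat.cast_nonneg (Z.height (Z.infoset i)) : (0 : ℝ) ≤ _)])
        (Real.sqrt_nonneg _))
    have h2 := pow_le_pow_left₀ (abs_nonneg _) h1 2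
    rwa [sq_abs, mul_pow, Real.sq_sqrt hS0] at h2
  refine (Finset.sum_le_card_nsmul _ _ _ hpt).trans ?_
  rw [nsmul_eq_mul, Finset.card_univ, mul_assoc]

/-- The dilated Euclidean regularizer, as a function of the behavioral strategy. -/
noncomputable def dilated (α : H → ℝ) (q : I → ℝ) : ℝ :=
  ∑ h, Z.parentMass (Z.toSeq q) h * (α h * euclReg (Z.slice q h))

/-- The counterfactual loss vector at `h`, for given loss vector `g` and strategy `q`. -/
noncomputable def cfLoss (α : H → ℝ) (τ : ℝ) (g q : I → ℝ) (h : H) : Z.Act h → ℝ :=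
  fun i => g i.1 + ∑ h' : {h' : H // Z.parent h' = some i.1}, Z.W α τ g q h'.1

theorem W_eq (α : H → ℝ) (τ : ℝ) (g q : I → ℝ) (h : H) :
    Z.W α τ g q h = Z.cfLoss α τ g q h ⬝ᵥ Z.slice q h + τ * α h * euclReg (Z.slice q h) := by
  rw [W, dotProduct_comm]
  rfl

/-- Summation over the information sets by their parents. -/
theorem sum_parentMass_mul (z : I → ℝ) (f : H → ℝ) :
    ∑ h, Z.parentMass z h * f h = ∑ h with Z.parent h = none, f h
      + ∑ i, z i * ∑ h' : {h' : H // Z.parent h' = some i}, f h'.1 := by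
  have e : ∀ i, ∑ h' : {h' : H // Z.parent h' = some i}, f h'.1
      = ∑ h, if Z.parent h = some i then f h else 0 := fun i => by
    rw [← Finset.sum_filter]
    exact (Finset.sum_subtype _ (by simp) f).symm
  simp only [e, Finset.mul_sum]
  rw [Finset.sum_comm, Finset.sum_filter, ← Finset.sum_add_distrib]
  refine Finset.sum_congr rfl fun h _ => ?_
  unfold parentMass
  cases hp : Z.parent h with
  | none => simp
  | some j =>
    simp only [Option.elim_some, reduceCtorEq, if_false, zero_add, Option.some.injEq, mul_ite,
      mul_zero, Finset.sum_ite_eq, Finset.mem_univ, if_true]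

theorem sum_parentMass_mul_dotProduct (q c : I → ℝ) :
    ∑ h, Z.parentMass (Z.toSeq q) h * ((fun i : Z.Act h => c i.1) ⬝ᵥ Z.slice q h)
      = c ⬝ᵥ Z.toSeq q := by
  rw [dotProduct, ← Fintype.sum_fiberwise Z.infoset]
  refine Finset.sum_congr rfl fun h _ => ?_
  rw [dotProduct, Finset.mul_sum]
  refine Finset.sum_congr rfl fun i _ => ?_
  rw [Z.toSeq_eq, i.2, slice]
  ring

theorem sum_parentMass_mul_cfLoss (α : H → ℝ) (τ : ℝ) (g q q' : I → ℝ) :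
    ∑ h, Z.parentMass (Z.toSeq q') h
      * (Z.W α τ g q h - Z.cfLoss α τ g q h ⬝ᵥ Z.slice q' h)
      = ∑ h with Z.parent h = none, Z.W α τ g q h - g ⬝ᵥ Z.toSeq q' := by
  have h1 := Z.sum_parentMass_mul (Z.toSeq q') (Z.W α τ g q)
  have h2 := Z.sum_parentMass_mul_dotProduct q'
    (fun i => g i + ∑ h' : {h' : H // Z.parent h' = some i}, Z.W α τ g q h'.1)
  have h3 : (fun i => g i + ∑ h' : {h' : H // Z.parent h' = some i}, Z.W α τ g q h'.1)
      ⬝ᵥ Z.toSeq q' = g ⬝ᵥ Z.toSeq q'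
        + ∑ i, Z.toSeq q' i * ∑ h' : {h' : H // Z.parent h' = some i}, Z.W α τ g q h'.1 := by
    simp only [dotProduct, add_mul, Finset.sum_add_distrib]
    congr 1
    exact Finset.sum_congr rfl fun i _ => mul_comm _ _
  simp only [mul_sub, Finset.sum_sub_distrib]
  rw [h1]
  change _ - ∑ h, Z.parentMass (Z.toSeq q') h * ((fun i : Z.Act h => g i.1 +
    ∑ h' : {h' : H // Z.parent h' = some i.1}, Z.W α τ g q h'.1) ⬝ᵥ Z.slice q' h) = _
  rw [h2, h3]
  ring

/-- Regret decomposition: the difference of the regularized losses of two strategies is the sum of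
the local differences at the information sets, weighted with the reach of the second strategy. -/
theorem regret_decomposition (α : H → ℝ) (τ : ℝ) (g q q' : I → ℝ) :
    g ⬝ᵥ Z.toSeq q + τ * Z.dilated α q - (g ⬝ᵥ Z.toSeq q' + τ * Z.dilated α q')
      = ∑ h, Z.parentMass (Z.toSeq q') h
        * (Z.cfLoss α τ g q h ⬝ᵥ (Z.slice q h - Z.slice q' h)
          + τ * α h * (euclReg (Z.slice q h) - euclReg (Z.slice q' h))) := by
  have key : ∀ p : I → ℝ, ∑ h, Z.parentMass (Z.toSeq p) h
        * (Z.cfLoss α τ g q h ⬝ᵥ (Z.slice q h - Z.slice p h)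
          + τ * α h * (euclReg (Z.slice q h) - euclReg (Z.slice p h)))
      = ∑ h with Z.parent h = none, Z.W α τ g q h - g ⬝ᵥ Z.toSeq p - τ * Z.dilated α p := by
    intro p
    rw [← Z.sum_parentMass_mul_cfLoss, dilated, Finset.mul_sum, ← Finset.sum_sub_distrib]
    refine Finset.sum_congr rfl fun h _ => ?_
    rw [W_eq, dotProduct_sub]
    ring
  have h1 := key q
  simp only [sub_self, dotProduct_zero, mul_zero, add_zero, Finset.sum_const_zero] at h1
  rw [key q']
  linarith

/-- The values at and below `h` depend only on the strategy at and below `h`. -/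
theorem W_congr (α : H → ℝ) (τ : ℝ) (g : I → ℝ) {q q' : I → ℝ} (h : H)
    (hqq : ∀ i, Z.height (Z.infoset i) ≤ Z.height h → q i = q' i) :
    Z.W α τ g q h = Z.W α τ g q' h := by
  induction hn : Z.height h using Nat.strong_induction_on generalizing h with
  | _ n ih =>
    subst hn
    have hs : Z.slice q h = Z.slice q' h := funext fun i => hqq i.1 (by rw [i.2])
    rw [W_eq, W_eq, hs]
    congr 2
    funext i
    unfold cfLoss
    congr 1
    refine Finset.sum_congr rfl fun h' _ => ?_
    have hlt := Z.height_lt h'.2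
    rw [i.2] at hlt
    exact ih _ hlt h'.1 (fun j hj => hqq j (hj.trans hlt.le)) rfl

theorem cfLoss_congr (α : H → ℝ) (τ : ℝ) (g : I → ℝ) {q q' : I → ℝ} (h : H)
    (hqq : ∀ i, Z.height (Z.infoset i) < Z.height h → q i = q' i) :
    Z.cfLoss α τ g q h = Z.cfLoss α τ g q' h := by
  funext i
  unfold cfLoss
  congr 1
  refine Finset.sum_congr rfl fun h' _ => ?_
  have hlt := Z.height_lt h'.2
  rw [i.2] at hlt
  exact Z.W_congr α τ g h'.1 fun j hj => hqq j (hj.trans_lt hlt)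

theorem euclReg_slice_mem_Icc {γ : ℝ} {q : I → ℝ} (hq : q ∈ Z.behavioral γ) (h : H) :
    euclReg (Z.slice q h) ∈ Set.Icc (0 : ℝ) 1 := by
  refine ⟨Finset.sum_nonneg fun _ _ => sq_nonneg _, ?_⟩
  rw [← (hq h).1.2]
  refine Finset.sum_le_sum fun i _ => ?_
  have := mem_Icc_of_mem_behavioral hq i.1
  unfold slice
  nlinarith [this.1, this.2]

theorem dilated_mem_Icc {γ : ℝ} {α : H → ℝ} (hα : ∀ h, 0 < α h) {q : I → ℝ}
    (hq : q ∈ Z.behavioral γ) : Z.dilated α q ∈ Set.Icc 0 (∑ h, α h) := by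
  have hm := Z.parentMass_mem_Icc (Z.toSeq_mem_Icc (mem_Icc_of_mem_behavioral hq))
  refine ⟨Finset.sum_nonneg fun h _ => mul_nonneg (hm h).1
    (mul_nonneg (hα h).le (Z.euclReg_slice_mem_Icc hq h).1), Finset.sum_le_sum fun h _ => ?_⟩
  refine (mul_le_of_le_one_left
    (mul_nonneg (hα h).le (Z.euclReg_slice_mem_Icc hq h).1) (hm h).2).trans ?_
  exact mul_le_of_le_one_right (hα h).le (Z.euclReg_slice_mem_Icc hq h).2

/-- The values are bounded uniformly over bounded losses, strategies and regularizations. -/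
theorem exists_abs_W_le (G : ℝ) : ∃ B : ℝ, 0 ≤ B ∧ ∀ (α : H → ℝ) (τ : ℝ) (g q : I → ℝ),
    (∀ h, 0 ≤ τ * α h) → (∀ h, τ * α h ≤ 1) → (∀ i, |g i| ≤ G) →
    (∀ i, q i ∈ Set.Icc (0 : ℝ) 1) → ∀ h, |Z.W α τ g q h| ≤ B := by
  have aux : ∀ n : ℕ, ∃ B : ℝ, 0 ≤ B ∧ ∀ (α : H → ℝ) (τ : ℝ) (g q : I → ℝ),
    (∀ h, 0 ≤ τ * α h) → (∀ h, τ * α h ≤ 1) → (∀ i, |g i| ≤ G) →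
    (∀ i, q i ∈ Set.Icc (0 : ℝ) 1) → ∀ h, Z.height h < n → |Z.W α τ g q h| ≤ B := by
    intro n
    induction n with
    | zero => exact ⟨0, le_rfl, fun _ _ _ _ _ _ _ _ h hh => absurd hh (Nat.not_lt_zero _)⟩
    | succ n ih =>
      obtain ⟨B, hB0, hB⟩ := ih
      have hD : 0 ≤ |G| + Fintype.card H * B + 1 := by positivity
      refine ⟨Fintype.card I * (|G| + Fintype.card H * B + 1), by positivity, ?_⟩
      intro α τ g q h0 h1 hg hq h hh
      have hterm : ∀ i : Z.Act h, |Z.cfLoss α τ g q h i| ≤ |G| + Fintype.card H * B := by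
        intro i
        unfold cfLoss
        refine (abs_add_le _ _).trans (add_le_add ((hg _).trans (le_abs_self G)) ?_)
        refine (Finset.abs_sum_le_sum_abs _ _).trans ?_
        have : ∀ h' ∈ (Finset.univ : Finset {h' : H // Z.parent h' = some i.1}),
            |Z.W α τ g q h'.1| ≤ B := fun h' _ => by
          have hlt := Z.height_lt h'.2
          rw [i.2] at hlt
          exact hB α τ g q h0 h1 hg hq h'.1 (by omega)
        refine (Finset.sum_le_card_nsmul _ _ _ this).trans ?_
        rw [nsmul_eq_mul, Finset.card_univ]
        refine mul_le_mul_of_nonneg_right ?_ hB0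
        exact_mod_cast Fintype.card_subtype_le _
      have e : Z.W α τ g q h = ∑ i : Z.Act h, (Z.cfLoss α τ g q h i * q i.1
          + τ * α h * q i.1 ^ 2) := by
        rw [W_eq, dotProduct, euclReg, Finset.mul_sum, ← Finset.sum_add_distrib]
        rfl
      rw [e]
      refine (Finset.abs_sum_le_sum_abs _ _).trans ?_
      have hb : ∀ i ∈ (Finset.univ : Finset (Z.Act h)), |Z.cfLoss α τ g q h i * q i.1
          + τ * α h * q i.1 ^ 2| ≤ |G| + Fintype.card H * B + 1 := by
        intro i _
        have hqi := hq i.1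
        refine (abs_add_le _ _).trans (add_le_add ?_ ?_)
        · rw [abs_mul, abs_of_nonneg hqi.1]
          exact (mul_le_of_le_one_right (abs_nonneg _) hqi.2).trans (hterm i)
        · rw [abs_of_nonneg (mul_nonneg (h0 h) (sq_nonneg _))]
          exact mul_le_one₀ (h1 h) (sq_nonneg _) (pow_le_one₀ hqi.1 hqi.2)
      refine (Finset.sum_le_card_nsmul _ _ _ hb).trans ?_
      rw [nsmul_eq_mul, Finset.card_univ]
      refine mul_le_mul_of_nonneg_right ?_ hD
      exact_mod_cast Fintype.card_subtype_le _
  obtain ⟨B, hB0, hB⟩ := aux Z.size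
  exact ⟨B, hB0, fun α τ g q h0 h1 hg hq h => hB α τ g q h0 h1 hg hq h (Z.height_lt_size h)⟩

end Behavioral

end Treeplex

/-! ### Equilibria of the regularized game -/

/-- The linear coefficient of a quadratic that is nonnegative to the right of zero. -/
theorem nonneg_of_forall_mul_add_sq {a c : ℝ}
    (h : ∀ s : ℝ, 0 < s → s ≤ 1 → 0 ≤ s * a + s ^ 2 * c) : 0 ≤ a := by
  by_contra! ha
  have hc : 0 < |c| + |a| + 1 := by positivity
  have hs : 0 < -a / (|c| + |a| + 1) := div_pos (by linarith) hc
  have h1 := h (-a / (|c| + |a| + 1)) hs (by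
    rw [div_le_one hc]; linarith [neg_le_abs a, abs_nonneg c])
  have h2 : 0 ≤ a + -a / (|c| + |a| + 1) * c := by
    refine nonneg_of_mul_nonneg_right (b := a + -a / (|c| + |a| + 1) * c) ?_ hs
    linarith [pow_two (-a / (|c| + |a| + 1))]
  have h3 : -a / (|c| + |a| + 1) * c < -a := by
    rw [div_mul_eq_mul_div, div_lt_iff₀ hc]
    refine mul_lt_mul_of_pos_left ?_ (by linarith)
    linarith [le_abs_self c, abs_nonneg a]
  linarith

section Simplex

variable {ι : Type} [Fintype ι]

theorem convex_perturbedSimplex (γ : ℝ) : Convex ℝ (perturbedSimplex γ ι) := by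
  have : perturbedSimplex γ ι = stdSimplex ℝ ι ∩ {p | ∀ i, γ ≤ p i} := rfl
  rw [this]
  refine (convex_stdSimplex ℝ ι).inter fun x hx y hy a b ha hb hab i => ?_
  have h1 := mul_le_mul_of_nonneg_left (hx i) ha
  have h2 := mul_le_mul_of_nonneg_left (hy i) hb
  simp only [Pi.add_apply, Pi.smul_apply, smul_eq_mul]
  have : γ = a * γ + b * γ := by rw [← add_mul, hab, one_mul]
  linarith

theorem isCompact_perturbedSimplex (γ : ℝ) : IsCompact (perturbedSimplex γ ι) := by
  have : perturbedSimplex γ ι = stdSimplex ℝ ι ∩ {p | ∀ i, γ ≤ p i} := rfl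
  rw [this]
  refine (isCompact_stdSimplex ℝ ι).inter_right ?_
  simp only [Set.ofPred_forall]
  exact isClosed_iInter fun i => isClosed_le continuous_const (continuous_apply i)

/-- First-order optimality for the minimization of a linear function plus two quadratic
penalties. -/
theorem IsMinOn.variational_inequality {K : Set (ι → ℝ)} (hK : Convex ℝ K) {f : (ι → ℝ) → ℝ}
    {v x₁ x₂ x : ι → ℝ} {a b : ℝ}
    (hf : ∀ p, f p = v ⬝ᵥ p + a * ∑ i, (p i - x₁ i) ^ 2 + b * ∑ i, (p i - x₂ i) ^ 2)
    (hx : x ∈ K) (hmin : IsMinOn f K x) {y : ι → ℝ} (hy : y ∈ K) :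
    0 ≤ ∑ i, (v i + 2 * a * (x i - x₁ i) + 2 * b * (x i - x₂ i)) * (y i - x i) := by
  refine nonneg_of_forall_mul_add_sq (c := (a + b) * ∑ i, (y i - x i) ^ 2) fun s hs hs1 => ?_
  have hmem : x + s • (y - x) ∈ K := hK.add_smul_sub_mem hx hy ⟨hs.le, hs1⟩
  have h := isMinOn_iff.1 hmin _ hmem
  have e : f (x + s • (y - x)) - f x
      = s * (∑ i, (v i + 2 * a * (x i - x₁ i) + 2 * b * (x i - x₂ i)) * (y i - x i))
        + s ^ 2 * ((a + b) * ∑ i, (y i - x i) ^ 2) := by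
    rw [hf, hf]
    simp only [dotProduct, Finset.mul_sum, ← Finset.sum_add_distrib, ← Finset.sum_sub_distrib,
      Pi.add_apply, Pi.smul_apply, Pi.sub_apply, smul_eq_mul]
    exact Finset.sum_congr rfl fun i _ => by ring
  linarith

/-- Quadratic growth at the minimizer of a Euclidean regularized linear loss. -/
theorem IsMinOn.quadratic_growth {K : Set (ι → ℝ)} (hK : Convex ℝ K) {v x : ι → ℝ} {β : ℝ}
    (hx : x ∈ K) (hmin : IsMinOn (fun p => v ⬝ᵥ p + β * euclReg p) K x) {y : ι → ℝ} (hy : y ∈ K) :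
    β * ∑ i, (x i - y i) ^ 2 ≤ v ⬝ᵥ (y - x) + β * (euclReg y - euclReg x) := by
  have h := IsMinOn.variational_inequality hK (v := v) (x₁ := 0) (x₂ := 0) (a := β) (b := 0)
    (by intro p; simp [euclReg]) hx hmin hy
  have e : v ⬝ᵥ (y - x) + β * (euclReg y - euclReg x) - β * ∑ i, (x i - y i) ^ 2
      = ∑ i, (v i + 2 * β * (x i - (0 : ι → ℝ) i) + 2 * 0 * (x i - (0 : ι → ℝ) i))
        * (y i - x i) := by
    simp only [dotProduct, euclReg, Finset.mul_sum, ← Finset.sum_add_distrib,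
      ← Finset.sum_sub_distrib, Pi.sub_apply, Pi.zero_apply]
    exact Finset.sum_congr rfl fun i _ => by ring
  linarith

end Simplex

namespace Treeplex

variable {H I : Type} [Fintype H] [DecidableEq H] [Fintype I] [DecidableEq I] (Z : Treeplex H I)

theorem continuous_slice (h : H) : Continuous fun q => Z.slice q h :=
  continuous_pi fun i => continuous_apply i.1

theorem isCompact_behavioral (γ : ℝ) : IsCompact (Z.behavioral γ) := by
  refine (isCompact_Icc (a := (0 : I → ℝ)) (b := 1)).of_isClosed_subset ?_ fun q hq =>
    ⟨fun i => (mem_Icc_of_mem_behavioral hq i).1, fun i => (mem_Icc_of_mem_behavioral hq i).2⟩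
  have : Z.behavioral γ = ⋂ h, (fun q => Z.slice q h) ⁻¹' perturbedSimplex γ (Z.Act h) := by
    ext q; simp [behavioral]
  rw [this]
  exact isClosed_iInter fun h =>
    (isCompact_perturbedSimplex γ).isClosed.preimage (Z.continuous_slice h)

theorem continuous_dilated (α : H → ℝ) : Continuous (Z.dilated α) := by
  unfold dilated euclReg slice
  refine continuous_finsetSum _ fun h _ =>
    ((Z.continuous_parentMass h).comp Z.continuous_toSeq).mul (continuous_const.mul ?_)
  exact continuous_finsetSum _ fun i _ => (continuous_apply i.1).pow 2

/-- The average of sequence forms is the sequence form of a behavioral strategy, and along such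
averages the dilated regularizer is convex. -/
theorem exists_average {γ : ℝ} {α : H → ℝ} (hα : ∀ h, 0 < α h) (p : ℕ → I → ℝ)
    (hp : ∀ t, p t ∈ Z.behavioral γ) (N : ℕ) :
    ∃ q ∈ Z.behavioral γ,
      (∀ i, (N + 1 : ℝ) * Z.toSeq q i = ∑ t ∈ Finset.range (N + 1), Z.toSeq (p t) i) ∧
      (N + 1 : ℝ) * Z.dilated α q ≤ ∑ t ∈ Finset.range (N + 1), Z.dilated α (p t) := by
  have hN : (0 : ℝ) < N + 1 := by positivity
  have hm0 : ∀ t h, 0 ≤ Z.parentMass (Z.toSeq (p t)) h := fun t h =>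
    (Z.parentMass_mem_Icc (Z.toSeq_mem_Icc (mem_Icc_of_mem_behavioral (hp t))) h).1
  obtain ⟨m, hm⟩ : ∃ m : H → ℝ, ∀ h,
      m h = ∑ t ∈ Finset.range (N + 1), Z.parentMass (Z.toSeq (p t)) h := ⟨_, fun _ => rfl⟩
  obtain ⟨z, hz⟩ : ∃ z : I → ℝ, ∀ i, z i = ∑ t ∈ Finset.range (N + 1), Z.toSeq (p t) i :=
    ⟨_, fun _ => rfl⟩
  have hmn : ∀ h, 0 ≤ m h := fun h => by
    rw [hm]; exact Finset.sum_nonneg fun t _ => hm0 t h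
  have hz' : ∀ h, ∀ i : Z.Act h, z i.1
      = ∑ t ∈ Finset.range (N + 1), Z.parentMass (Z.toSeq (p t)) h * Z.slice (p t) h i := by
    intro h i
    rw [hz]
    refine Finset.sum_congr rfl fun t _ => ?_
    rw [Z.toSeq_eq, i.2, mul_comm]
    rfl
  obtain ⟨q, hq⟩ : ∃ q : I → ℝ, ∀ i, q i = if m (Z.infoset i) = 0 then p 0 i
    else z i / m (Z.infoset i) := ⟨_, fun _ => rfl⟩
  have hqz : ∀ i, z i = q i * m (Z.infoset i) := by
    intro i
    rw [hq]
    split_ifs with h0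
    · rw [h0, mul_zero, hz' _ ⟨i, rfl⟩]
      refine Finset.sum_eq_zero fun t ht => ?_
      rw [hm, Finset.sum_eq_zero_iff_of_nonneg fun t _ => hm0 t _] at h0
      rw [h0 t ht, zero_mul]
    · rw [div_mul_cancel₀ _ h0]
  have hseq : (fun i => z i / (N + 1)) = Z.toSeq q := by
    refine Z.eq_toSeq fun i => ?_
    have : Z.parentMass (fun i => z i / (N + 1)) (Z.infoset i) = m (Z.infoset i) / (N + 1) := by
      rw [hm]
      unfold parentMass
      cases Z.parent (Z.infoset i) with
      | none =>
        simp only [Option.elim_none, Finset.sum_const, Finset.card_range, nsmul_eq_mul, mul_one,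
          Nat.cast_add, Nat.cast_one]
        exact (div_self hN.ne').symm
      | some j => simp only [Option.elim_some, hz]
    rw [this, hqz i]
    ring
  have hmass : ∀ h, (N + 1 : ℝ) * Z.parentMass (Z.toSeq q) h = m h := by
    intro h
    rw [← hseq, hm]
    unfold parentMass
    cases Z.parent h with
    | none => simp
    | some j =>
      simp only [Option.elim_some, ← hz]
      exact mul_div_cancel₀ _ hN.ne'
  refine ⟨q, fun h => ?_, fun i => ?_, ?_⟩
  · by_cases h0 : m h = 0
    · have : Z.slice q h = Z.slice (p 0) h := by
        funext i
        simp only [slice, hq, i.2, h0, if_true]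
      rw [this]
      exact hp 0 h
    · have hs : Z.slice q h = fun i => z i.1 / m h := by
        funext i
        simp only [slice, hq, i.2, h0, if_false]
      have hpos : 0 < m h := lt_of_le_of_ne (hmn h) (Ne.symm h0)
      rw [hs]
      refine ⟨⟨fun i => div_nonneg ?_ (hmn h), ?_⟩, fun i => ?_⟩
      · rw [hz' h i]
        exact Finset.sum_nonneg fun t _ => mul_nonneg (hm0 t h) ((hp t h).1.1 i)
      · rw [← Finset.sum_div, div_eq_one_iff_eq h0, hm]
        simp only [hz' h]
        rw [Finset.sum_comm]
        refine Finset.sum_congr rfl fun t _ => ?_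
        rw [← Finset.mul_sum, (hp t h).1.2, mul_one]
      · rw [le_div_iff₀ hpos, hz' h i, hm, Finset.mul_sum]
        refine Finset.sum_le_sum fun t _ => ?_
        rw [mul_comm]
        exact mul_le_mul_of_nonneg_left ((hp t h).2 i) (hm0 t h)
  · rw [← hseq, ← hz]
    exact mul_div_cancel₀ _ hN.ne'
  · unfold dilated
    rw [Finset.sum_comm, Finset.mul_sum]
    refine Finset.sum_le_sum fun h _ => ?_
    rw [← mul_assoc, hmass]
    have hloc : ∀ i : Z.Act h, m h * Z.slice q h i ^ 2
        ≤ ∑ t ∈ Finset.range (N + 1), Z.parentMass (Z.toSeq (p t)) h * Z.slice (p t) h i ^ 2 := by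
      intro i
      have h1 : 0 ≤ ∑ t ∈ Finset.range (N + 1), Z.parentMass (Z.toSeq (p t)) h
          * (Z.slice (p t) h i - Z.slice q h i) ^ 2 :=
        Finset.sum_nonneg fun t _ => mul_nonneg (hm0 t h) (sq_nonneg _)
      have h2 : ∑ t ∈ Finset.range (N + 1), Z.parentMass (Z.toSeq (p t)) h
            * (Z.slice (p t) h i - Z.slice q h i) ^ 2
          = ∑ t ∈ Finset.range (N + 1), Z.parentMass (Z.toSeq (p t)) h * Z.slice (p t) h i ^ 2
            - 2 * Z.slice q h i * z i.1 + Z.slice q h i ^ 2 * m h := by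
        rw [hz' h i, hm, Finset.mul_sum, Finset.mul_sum, ← Finset.sum_sub_distrib,
          ← Finset.sum_add_distrib]
        exact Finset.sum_congr rfl fun t _ => by ring
      have h3 : z i.1 = Z.slice q h i * m h := by
        have := hqz i.1
        rwa [i.2] at this
      rw [h2, h3] at h1
      linarith
    calc m h * (α h * euclReg (Z.slice q h))
        = α h * ∑ i : Z.Act h, m h * Z.slice q h i ^ 2 := by
          rw [euclReg, ← Finset.mul_sum]; ring
      _ ≤ α h * ∑ i : Z.Act h, ∑ t ∈ Finset.range (N + 1),
            Z.parentMass (Z.toSeq (p t)) h * Z.slice (p t) h i ^ 2 :=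
          mul_le_mul_of_nonneg_left (Finset.sum_le_sum fun i _ => hloc i) (hα h).le
      _ = _ := by
          rw [Finset.sum_comm, Finset.mul_sum]
          refine Finset.sum_congr rfl fun t _ => ?_
          rw [euclReg, ← Finset.mul_sum]; ring

/-- Backward induction: for a fixed loss vector there is a behavioral strategy that is optimal at
every information set, reached or not. -/
theorem exists_backward_induction {γ : ℝ} (hne : (Z.behavioral γ).Nonempty) (α : H → ℝ) (τ : ℝ)
    (g : I → ℝ) :
    ∃ q ∈ Z.behavioral γ, ∀ h, IsMinOn
      (fun p : Z.Act h → ℝ => Z.cfLoss α τ g q h ⬝ᵥ p + τ * α h * euclReg p)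
      (perturbedSimplex γ (Z.Act h)) (Z.slice q h) := by
  have aux : ∀ n : ℕ, ∃ q ∈ Z.behavioral γ, ∀ h, Z.height h < n → IsMinOn
      (fun p : Z.Act h → ℝ => Z.cfLoss α τ g q h ⬝ᵥ p + τ * α h * euclReg p)
      (perturbedSimplex γ (Z.Act h)) (Z.slice q h) := by
    intro n
    induction n with
    | zero =>
      obtain ⟨q, hq⟩ := hne
      exact ⟨q, hq, fun h hh => absurd hh (Nat.not_lt_zero _)⟩
    | succ n ih =>
      obtain ⟨q, hq, hmin⟩ := ih
      have hex : ∀ h, ∃ x ∈ perturbedSimplex γ (Z.Act h), IsMinOn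
          (fun p : Z.Act h → ℝ => Z.cfLoss α τ g q h ⬝ᵥ p + τ * α h * euclReg p)
          (perturbedSimplex γ (Z.Act h)) x := by
        intro h
        refine (isCompact_perturbedSimplex γ).exists_isMinOn ⟨_, hq h⟩ (Continuous.continuousOn ?_)
        unfold dotProduct euclReg
        fun_prop
      choose x hx hxmin using hex
      obtain ⟨q', hq'⟩ : ∃ q' : I → ℝ, ∀ i, q' i = if Z.height (Z.infoset i) = n
        then x (Z.infoset i) ⟨i, rfl⟩ else q i := ⟨_, fun _ => rfl⟩
      have hs1 : ∀ h, Z.height h = n → Z.slice q' h = x h := by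
        intro h hh
        funext i
        obtain ⟨i, rfl⟩ := i
        rw [slice, hq', if_pos hh]
      have hs2 : ∀ h, Z.height h ≠ n → Z.slice q' h = Z.slice q h := by
        intro h hh
        funext i
        obtain ⟨i, rfl⟩ := i
        rw [slice, hq', if_neg hh]
        rfl
      have hc : ∀ h, Z.height h ≤ n → Z.cfLoss α τ g q' h = Z.cfLoss α τ g q h := by
        intro h hh
        refine Z.cfLoss_congr α τ g h fun i hi => ?_
        rw [hq', if_neg (by omega)]
      refine ⟨q', fun h => ?_, fun h hh => ?_⟩
      · by_cases hn : Z.height h = n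
        · rw [hs1 h hn]; exact hx h
        · rw [hs2 h hn]; exact hq h
      · rw [hc h (by omega)]
        by_cases hn : Z.height h = n
        · rw [hs1 h hn]; exact hxmin h
        · rw [hs2 h hn]; exact hmin h (by omega)
  obtain ⟨q, hq, hmin⟩ := aux Z.size
  exact ⟨q, hq, fun h => hmin h (Z.height_lt_size h)⟩

/-- Strategies with vanishing average regret certify an equilibrium of the regularized game: a
cluster point of their averages is one.  Replacing its behavioral form by the one from backward
induction gives quadratic growth at all information sets. -/
theorem exists_equilibrium {F : (I → ℝ) →ₗ[ℝ] (I → ℝ)} (hF : ∀ z, F z ⬝ᵥ z = 0) {α : H → ℝ}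
    (hα : ∀ h, 0 < α h) {τ γ : ℝ} (hτ : 0 < τ) {p : ℕ → I → ℝ} (hp : ∀ t, p t ∈ Z.behavioral γ)
    {r : ℕ → ℝ} (hr : Filter.Tendsto r Filter.atTop (nhds 0))
    (hreg : ∀ q ∈ Z.behavioral γ, ∀ N : ℕ, ∑ t ∈ Finset.range (N + 1),
      (F (Z.toSeq (p t)) ⬝ᵥ Z.toSeq (p t) + τ * Z.dilated α (p t)
        - (F (Z.toSeq (p t)) ⬝ᵥ Z.toSeq q + τ * Z.dilated α q)) ≤ (N + 1) * r N) :
    ∃ q' ∈ Z.behavioral γ, ∀ q ∈ Z.behavioral γ,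
      τ * ∑ h, Z.parentMass (Z.toSeq q) h * (α h * ∑ i : Z.Act h, (q i.1 - q' i.1) ^ 2)
        ≤ F (Z.toSeq q') ⬝ᵥ Z.toSeq q + τ * Z.dilated α q
          - (F (Z.toSeq q') ⬝ᵥ Z.toSeq q' + τ * Z.dilated α q') := by
  choose a ha haz had using fun N => Z.exists_average hα p hp N
  obtain ⟨q₀, hq₀, φ, hφ, hlim⟩ := (Z.isCompact_behavioral γ).tendsto_subseq ha
  have hFc : Continuous F := F.continuous_of_finiteDimensional
  have hopt : ∀ q ∈ Z.behavioral γ,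
      τ * Z.dilated α q₀ ≤ F (Z.toSeq q₀) ⬝ᵥ Z.toSeq q + τ * Z.dilated α q := by
    intro q hq
    have hN : ∀ N, τ * Z.dilated α (a N) - (F (Z.toSeq (a N)) ⬝ᵥ Z.toSeq q + τ * Z.dilated α q)
        ≤ r N := by
      intro N
      have hpos : (0 : ℝ) < N + 1 := by positivity
      refine le_of_mul_le_mul_left (le_trans ?_ (hreg q hq N)) hpos
      simp only [hF, zero_add, Finset.sum_sub_distrib, Finset.sum_add_distrib, Finset.sum_const,
        Finset.card_range, nsmul_eq_mul, ← Finset.mul_sum, ← sum_dotProduct]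
      have e : (N + 1 : ℝ) • Z.toSeq (a N) = ∑ t ∈ Finset.range (N + 1), Z.toSeq (p t) := by
        funext i
        rw [Finset.sum_apply, ← haz N i]
        rfl
      rw [← map_sum, ← e, map_smul, smul_dotProduct, smul_eq_mul]
      have := mul_le_mul_of_nonneg_left (had N) hτ.le
      push_cast
      linarith
    have hcont : Continuous fun x => τ * Z.dilated α x
        - (F (Z.toSeq x) ⬝ᵥ Z.toSeq q + τ * Z.dilated α q) := by
      refine (continuous_const.mul (Z.continuous_dilated α)).sub (Continuous.add ?_ continuous_const)
      exact (hFc.comp Z.continuous_toSeq).dotProduct continuous_const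
    have h1 := le_of_tendsto_of_tendsto' ((hcont.tendsto q₀).comp hlim)
      (hr.comp hφ.tendsto_atTop) fun N => hN (φ N)
    linarith
  -- `q'` is optimal against the loss of `q₀`; the growth around `q'` forces the same sequence form
  obtain ⟨q', hq', hmin⟩ := Z.exists_backward_induction ⟨q₀, hq₀⟩ α τ (F (Z.toSeq q₀))
  have hgrow : ∀ q ∈ Z.behavioral γ,
      τ * ∑ h, Z.parentMass (Z.toSeq q) h * (α h * ∑ i : Z.Act h, (q i.1 - q' i.1) ^ 2)
        ≤ F (Z.toSeq q₀) ⬝ᵥ Z.toSeq q + τ * Z.dilated α q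
          - (F (Z.toSeq q₀) ⬝ᵥ Z.toSeq q' + τ * Z.dilated α q') := by
    intro q hq
    have hd := Z.regret_decomposition α τ (F (Z.toSeq q₀)) q' q
    have hm := Z.parentMass_mem_Icc (Z.toSeq_mem_Icc (mem_Icc_of_mem_behavioral hq))
    rw [← neg_sub, hd, Finset.mul_sum, ← Finset.sum_neg_distrib]
    refine Finset.sum_le_sum fun h _ => ?_
    have hl := IsMinOn.quadratic_growth (convex_perturbedSimplex γ) (hq' h) (hmin h) (hq h)
    have e : ∑ i : Z.Act h, (q i.1 - q' i.1) ^ 2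
        = ∑ i, (Z.slice q' h i - Z.slice q h i) ^ 2 :=
      Finset.sum_congr rfl fun i _ => by unfold slice; ring
    have h2 := mul_le_mul_of_nonneg_left hl (hm h).1
    rw [dotProduct_sub] at h2 ⊢
    rw [e]
    linarith
  have heq : Z.toSeq q₀ = Z.toSeq q' := by
    have h1 := hgrow q₀ hq₀
    have h2 := hopt q' hq'
    rw [hF] at h1
    have hm := Z.parentMass_mem_Icc (Z.toSeq_mem_Icc (mem_Icc_of_mem_behavioral hq₀))
    have hterm : ∀ h ∈ Finset.univ, 0 ≤ Z.parentMass (Z.toSeq q₀) h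
        * (α h * ∑ i : Z.Act h, (q₀ i.1 - q' i.1) ^ 2) := fun h _ =>
      mul_nonneg (hm h).1 (mul_nonneg (hα h).le (Finset.sum_nonneg fun _ _ => sq_nonneg _))
    have h3 : ∑ h, Z.parentMass (Z.toSeq q₀) h
        * (α h * ∑ i : Z.Act h, (q₀ i.1 - q' i.1) ^ 2) ≤ 0 := by
      refine nonpos_of_mul_nonpos_right (a := τ) ?_ hτ
      linarith
    have h4 := (Finset.sum_eq_zero_iff_of_nonneg hterm).1
      (le_antisymm h3 (Finset.sum_nonneg hterm))
    have h5 : ∑ h, Z.parentMass (Z.toSeq q₀) h * ∑ i : Z.Act h, (q₀ i.1 - q' i.1) ^ 2 = 0 := by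
      refine Finset.sum_eq_zero fun h hh => ?_
      have := h4 h hh
      rw [mul_left_comm] at this
      exact (mul_eq_zero.1 this).resolve_left (hα h).ne'
    have h6 := Z.sum_sq_toSeq_sub_le (mem_Icc_of_mem_behavioral hq₀) (mem_Icc_of_mem_behavioral hq')
    rw [h5, mul_zero] at h6
    have h7 := (Finset.sum_eq_zero_iff_of_nonneg fun i _ => sq_nonneg _).1
      (le_antisymm h6 (Finset.sum_nonneg fun i _ => sq_nonneg _))
    funext i
    exact sub_eq_zero.1 (pow_eq_zero_iff two_ne_zero |>.1 (h7 i (Finset.mem_univ i)))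
  rw [heq] at hgrow
  exact ⟨q', hq', hgrow⟩

end Treeplex

/-! ### Runs of Reg-CFR -/

open WithLp in
theorem norm_toLp_sub_sq {ι : Type} [Fintype ι] (x y : ι → ℝ) :
    ‖toLp 2 x - toLp 2 y‖ ^ 2 = ∑ i, (x i - y i) ^ 2 := by
  rw [EuclideanSpace.real_norm_sq_eq]
  rfl

open scoped RealInnerProductSpace in
open WithLp in
theorem regLoss_toLp {ι : Type} [Fintype ι] (β : ℝ) (v x : ι → ℝ) :
    regLoss β (toLp 2 v) (toLp 2 x) = v ⬝ᵥ x + β * euclReg x := by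
  rw [regLoss, EuclideanSpace.inner_toLp_toLp, EuclideanSpace.real_norm_sq_eq, dotProduct_comm]
  rfl

theorem bregman_eq {ι : Type} [Fintype ι] (u v : ι → ℝ) :
    bregman u v = ∑ i, (u i - v i) ^ 2 := by
  unfold bregman euclReg euclRegGrad dotProduct
  rw [← Finset.sum_sub_distrib, ← Finset.sum_sub_distrib]
  exact Finset.sum_congr rfl fun i _ => by simp only [Pi.sub_apply]; ring

/-- A linear map on `ℝ^I` is bounded, from the Euclidean norm to each coordinate. -/
theorem exists_sq_apply_le {I : Type} [Fintype I] (F : (I → ℝ) →ₗ[ℝ] (I → ℝ)) :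
    ∃ L : ℝ, 0 ≤ L ∧ ∀ z i, F z i ^ 2 ≤ L * ∑ j, z j ^ 2 := by
  classical
  refine ⟨∑ i, ∑ j, F (fun k => if j = k then 1 else 0) i ^ 2, by positivity, fun z i => ?_⟩
  have e : F z i = ∑ j, F (fun k => if j = k then 1 else 0) i * z j := by
    rw [LinearMap.pi_apply_eq_sum_univ F z, Finset.sum_apply]
    exact Finset.sum_congr rfl fun j _ => by rw [Pi.smul_apply, smul_eq_mul, mul_comm]
  rw [e]
  refine (Finset.sum_mul_sq_le_sq_mul_sq _ _ _).trans
    (mul_le_mul_of_nonneg_right ?_ (Finset.sum_nonneg fun _ _ => sq_nonneg _))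
  exact Finset.single_le_sum (f := fun i => ∑ j, F (fun k => if j = k then 1 else 0) i ^ 2)
    (fun i _ => Finset.sum_nonneg fun _ _ => sq_nonneg _) (Finset.mem_univ i)

namespace Treeplex

open WithLp

variable {H I : Type} [Fintype H] [DecidableEq H] [Fintype I] [DecidableEq I] (Z : Treeplex H I)

theorem sum_sq_le_card {z : I → ℝ} (hz : ∀ i, |z i| ≤ 1) : ∑ i, z i ^ 2 ≤ Fintype.card I := by
  refine (Finset.sum_le_card_nsmul _ _ 1 fun i _ => ?_).trans (by simp)
  rw [← sq_abs]
  exact pow_le_one₀ (abs_nonneg _) (hz i)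

/-- The counterfactual losses and the values are bounded, uniformly in the strategy and in small
`τ`. -/
theorem exists_bounds (F : (I → ℝ) →ₗ[ℝ] (I → ℝ)) (α : H → ℝ) :
    ∃ B : ℝ, 0 ≤ B ∧ ∀ τ, (∀ h, 0 ≤ τ * α h) → (∀ h, τ * α h ≤ 1) →
      ∀ q : I → ℝ, (∀ i, q i ∈ Set.Icc (0 : ℝ) 1) → ∀ h,
        ‖toLp 2 (Z.V F α τ q h)‖ ≤ B ∧ |Z.W α τ (F (Z.toSeq q)) q h| ≤ B := by
  obtain ⟨L, hL0, hL⟩ := exists_sq_apply_le F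
  have hG : ∀ q : I → ℝ, (∀ i, q i ∈ Set.Icc (0 : ℝ) 1) →
      ∀ i, |F (Z.toSeq q) i| ≤ √(L * Fintype.card I) := by
    intro q hq i
    refine Real.le_sqrt_of_sq_le ?_
    rw [sq_abs]
    refine (hL _ _).trans (mul_le_mul_of_nonneg_left (sum_sq_le_card fun i => ?_) hL0)
    have := Z.toSeq_mem_Icc hq i
    rw [abs_of_nonneg this.1]
    exact this.2
  obtain ⟨B, hB0, hB⟩ := Z.exists_abs_W_le (√(L * Fintype.card I))
  have hb : 0 ≤ √(L * Fintype.card I) + Fintype.card H * B := by positivity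
  refine ⟨B + √(Fintype.card I * (√(L * Fintype.card I) + Fintype.card H * B) ^ 2),
    by positivity, ?_⟩
  intro τ h0 h1 q hq h
  refine ⟨?_, (hB α τ _ q h0 h1 (hG q hq) hq h).trans
    (le_add_of_nonneg_right (Real.sqrt_nonneg _))⟩
  refine le_trans (Real.le_sqrt_of_sq_le ?_) (le_add_of_nonneg_left hB0)
  rw [EuclideanSpace.real_norm_sq_eq]
  have hterm : ∀ i ∈ (Finset.univ : Finset (Z.Act h)), Z.V F α τ q h i ^ 2
      ≤ (√(L * Fintype.card I) + Fintype.card H * B) ^ 2 := by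
    intro i _
    rw [← sq_abs]
    refine pow_le_pow_left₀ (abs_nonneg _) ?_ 2
    refine (abs_add_le _ _).trans (add_le_add (hG q hq i.1) ?_)
    refine (Finset.abs_sum_le_sum_abs _ _).trans ?_
    refine (Finset.sum_le_card_nsmul _ _ B fun h' _ =>
      hB α τ _ q h0 h1 (hG q hq) hq h'.1).trans ?_
    rw [nsmul_eq_mul, Finset.card_univ]
    refine mul_le_mul_of_nonneg_right ?_ hB0
    exact_mod_cast Fintype.card_subtype_le _
  refine (Finset.sum_le_card_nsmul _ _ _ hterm).trans ?_
  rw [nsmul_eq_mul, Finset.card_univ]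
  refine mul_le_mul_of_nonneg_right ?_ (sq_nonneg _)
  exact_mod_cast Fintype.card_subtype_le _

theorem IsRegCFR.mem_behavioral {F : (I → ℝ) → I → ℝ} {α : H → ℝ} {τ κ γ : ℝ}
    {q qHalf : ℕ → I → ℝ} (R : Z.IsRegCFR F α τ κ γ q qHalf) (t : ℕ) :
    q (t + 1) ∈ Z.behavioral γ := fun h => R.mem t h

theorem IsRegCFR.mem_behavioral_half {F : (I → ℝ) → I → ℝ} {α : H → ℝ} {τ κ γ : ℝ}
    {q qHalf : ℕ → I → ℝ} (R : Z.IsRegCFR F α τ κ γ q qHalf) (t : ℕ) :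
    qHalf (t + 1) ∈ Z.behavioral γ := fun h => R.mem_half t h

/-- At time `0` this holds for the uniform strategy, which need not be in `behavioral γ`. -/
theorem IsRegCFR.half_mem_Icc {F : (I → ℝ) → I → ℝ} {α : H → ℝ} {τ κ γ : ℝ}
    {q qHalf : ℕ → I → ℝ} (R : Z.IsRegCFR F α τ κ γ q qHalf) (t : ℕ) (i : I) :
    qHalf t i ∈ Set.Icc (0 : ℝ) 1 := by
  cases t with
  | zero =>
    rw [R.init_half]
    refine ⟨by positivity, ?_⟩
    have : 0 < Fintype.card (Z.Act (Z.infoset i)) := Fintype.card_pos_iff.2 ⟨⟨i, rfl⟩⟩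
    refine div_le_one_of_le₀ ?_ (by positivity)
    exact_mod_cast this
  | succ t => exact mem_Icc_of_mem_behavioral (R.mem_behavioral_half Z t) i

/-- The squared inverse stepsizes, with the variation written as a Euclidean norm. -/
theorem stepsize_sq (F : (I → ℝ) → I → ℝ) (α : H → ℝ) (τ : ℝ) {κ : ℝ} (hκ : 1 ≤ κ)
    (qHalf : ℕ → I → ℝ) (h : H) (N : ℕ) :
    Z.stepsize F α τ κ qHalf h (N + 1) ^ 2 = κ + ∑ t ∈ Finset.range N,
      ‖toLp 2 (Z.V F α τ (qHalf (t + 1)) h) - toLp 2 (Z.V F α τ (qHalf t) h)‖ ^ 2 := by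
  have e : ∑ s ∈ Finset.Ico 1 (N + 1), Z.variation F α τ qHalf h s = ∑ t ∈ Finset.range N,
      ‖toLp 2 (Z.V F α τ (qHalf (t + 1)) h) - toLp 2 (Z.V F α τ (qHalf t) h)‖ ^ 2 := by
    rw [Finset.sum_Ico_eq_sum_range]
    refine Finset.sum_congr rfl fun t _ => ?_
    rw [norm_toLp_sub_sq, variation, add_comm 1 t]
    rfl
  rw [stepsize, e, Real.sq_sqrt]
  exact add_nonneg (by linarith) (Finset.sum_nonneg fun _ _ => sq_nonneg _)

/-- At every information set, a run of Reg-CFR is a proximal recursion. -/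
theorem IsRegCFR.proxRun {F : (I → ℝ) → I → ℝ} {α : H → ℝ} {τ κ γ B : ℝ}
    {q qHalf : ℕ → I → ℝ} (R : Z.IsRegCFR F α τ κ γ q qHalf) (hκ : 1 ≤ κ) (h : H)
    (h0 : 0 ≤ τ * α h) (h1 : τ * α h ≤ 1)
    (hB : ∀ t, ‖toLp 2 (Z.V F α τ (qHalf t) h)‖ ≤ B) :
    ProxRun {x : EuclideanSpace ℝ (Z.Act h) | ofLp x ∈ perturbedSimplex γ (Z.Act h)} (τ * α h) B
      (fun t => toLp 2 (Z.V F α τ (qHalf t) h)) (fun t => toLp 2 (Z.slice (q (t + 1)) h))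
      (fun t => toLp 2 (Z.slice (qHalf (t + 1)) h))
      (fun t => Z.stepsize F α τ κ qHalf h (t + 1)) where
  norm_le x hx := by
    refine (sq_le_one_iff₀ (norm_nonneg _)).1 ?_
    rw [EuclideanSpace.real_norm_sq_eq, ← hx.1.2]
    refine Finset.sum_le_sum fun i _ => ?_
    have h2 : x i ≤ 1 := by
      have := Finset.single_le_sum (f := fun i => x i) (fun j _ => hx.1.1 j) (Finset.mem_univ i)
      exact this.trans hx.1.2.le
    rw [pow_two]
    exact mul_le_of_le_one_right (hx.1.1 i) h2
  β_nonneg := h0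
  β_le := h1
  V_le := hB
  q_mem t := R.mem t h
  p_mem t := R.mem_half t h
  one_le t := by
    refine Real.one_le_sqrt.2 (hκ.trans (le_add_of_nonneg_right ?_))
    exact Finset.sum_nonneg fun s _ => Finset.sum_nonneg fun i _ => sq_nonneg _
  sq_succ t := by
    rw [Z.stepsize_sq F α τ hκ, Z.stepsize_sq F α τ hκ, Finset.sum_range_succ, add_assoc]
  step t x hx := by
    have := IsMinOn.variational_inequality (convex_perturbedSimplex γ)
      (fun p => by rw [bregman_eq, bregman_eq]) (R.mem (t + 1) h) (R.step (t + 1) h) hx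
    refine this.trans_eq ?_
    rw [PiLp.inner_apply]
    refine Finset.sum_congr rfl fun i _ => ?_
    simp [euclRegGrad]
    ring
  half t x hx := by
    have := IsMinOn.variational_inequality (convex_perturbedSimplex γ)
      (v := Z.V F α τ (qHalf t) h + (τ * α h) • euclRegGrad (Z.slice (q (t + 1)) h))
      (a := Z.stepsize F α τ κ qHalf h (t + 1)) (x₁ := Z.slice (q (t + 1)) h) (b := 0) (x₂ := 0)
      (fun p => by rw [bregman_eq, zero_mul, add_zero]) (R.mem_half t h) (R.step_half t h) hx
    refine this.trans_eq ?_
    rw [PiLp.inner_apply]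
    refine Finset.sum_congr rfl fun i _ => ?_
    simp [euclRegGrad]
    ring

theorem W_eq_regLoss (F : (I → ℝ) → I → ℝ) (α : H → ℝ) (τ : ℝ) (q : I → ℝ) (h : H) :
    Z.W α τ (F (Z.toSeq q)) q h
      = regLoss (τ * α h) (toLp 2 (Z.V F α τ q h)) (toLp 2 (Z.slice q h)) := by
  rw [W_eq, regLoss_toLp]
  rfl

end Treeplex

/-! ### Convergence of Reg-CFR to the regularized equilibrium -/

namespace Treeplex

open WithLp

variable {H I : Type} [Fintype H] [DecidableEq H] [Fintype I] [DecidableEq I] (Z : Treeplex H I)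

/-- At a single information set, the variation of the values is controlled by the variation of
the counterfactual losses. -/
theorem exists_sum_sq_W_sub_le (F : (I → ℝ) →ₗ[ℝ] (I → ℝ)) (α : H → ℝ) {κ : ℝ} (hκ : 1 ≤ κ) :
    ∃ C : ℝ, 0 ≤ C ∧ ∀ (τ γ : ℝ) (q qHalf : ℕ → I → ℝ), (∀ h, 0 ≤ τ * α h) →
      (∀ h, τ * α h ≤ 1) → Z.IsRegCFR F α τ κ γ q qHalf → ∀ h N,
      ∑ t ∈ Finset.range N, (Z.W α τ (F (Z.toSeq (qHalf (t + 1)))) (qHalf (t + 1)) h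
          - Z.W α τ (F (Z.toSeq (qHalf t))) (qHalf t) h) ^ 2
        ≤ C * (1 + ∑ t ∈ Finset.range N,
          ‖toLp 2 (Z.V F α τ (qHalf (t + 1)) h) - toLp 2 (Z.V F α τ (qHalf t) h)‖ ^ 2) := by
  obtain ⟨B, hB0, hB⟩ := Z.exists_bounds F α
  have hex := fun h : H => ProxRun.sum_sq_value_sub_le (E := EuclideanSpace ℝ (Z.Act h)) B (√κ)
    (Real.one_le_sqrt.2 hκ)
  choose C hC0 hC using hex
  have hCs : 0 ≤ ∑ h, C h := Finset.sum_nonneg fun h _ => hC0 h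
  refine ⟨(2 * B) ^ 2 + ∑ h, C h, by positivity, ?_⟩
  intro τ γ q qHalf h0 h1 R h N
  have hBt := fun t => hB τ h0 h1 (qHalf t) (R.half_mem_Icc Z t)
  have hrun := hC h _ _ _ _ _ _ (R.proxRun Z hκ h (h0 h) (h1 h) fun t => (hBt t h).1) (by
    simp [stepsize])
  have hw : ∀ N, 0 ≤ ∑ t ∈ Finset.range N,
      ‖toLp 2 (Z.V F α τ (qHalf (t + 1)) h) - toLp 2 (Z.V F α τ (qHalf t) h)‖ ^ 2 :=
    fun N => Finset.sum_nonneg fun _ _ => sq_nonneg _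
  rcases N with _ | N
  · simp only [Finset.range_zero, Finset.sum_empty]
    positivity
  · have h2 := hrun N
    simp only [← Z.W_eq_regLoss] at h2
    -- the first difference involves the uniform strategy, which precedes the proximal recursion
    rw [Finset.sum_range_succ']
    have h3 : (Z.W α τ (F (Z.toSeq (qHalf (0 + 1)))) (qHalf (0 + 1)) h
        - Z.W α τ (F (Z.toSeq (qHalf 0))) (qHalf 0) h) ^ 2 ≤ (2 * B) ^ 2 := by
      rw [← sq_abs]
      refine pow_le_pow_left₀ (abs_nonneg _) ?_ 2
      refine (abs_sub _ _).trans ?_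
      linarith [(hBt 0 h).2, (hBt (0 + 1) h).2]
    have h4 : C h ≤ ∑ h, C h := Finset.single_le_sum (fun h _ => hC0 h) (Finset.mem_univ h)
    have h5 := mul_le_mul_of_nonneg_right h4 (add_nonneg zero_le_one (hw (N + 1)))
    have h6 := mul_nonneg (sq_nonneg (2 * B)) (hw (N + 1))
    refine (add_le_add h2 h3).trans ?_
    linarith

/-- The variation of all counterfactual losses is controlled by the variation of the sequence
form alone: by induction from the leaves, the values of the children contribute no more than
their own counterfactual losses vary. -/
theorem exists_sum_sq_V_sub_le (F : (I → ℝ) →ₗ[ℝ] (I → ℝ)) (α : H → ℝ) {κ : ℝ} (hκ : 1 ≤ κ) :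
    ∃ C : ℝ, 0 ≤ C ∧ ∀ (τ γ : ℝ) (q qHalf : ℕ → I → ℝ), (∀ h, 0 ≤ τ * α h) →
      (∀ h, τ * α h ≤ 1) → Z.IsRegCFR F α τ κ γ q qHalf → ∀ h N,
      ∑ t ∈ Finset.range N,
          ‖toLp 2 (Z.V F α τ (qHalf (t + 1)) h) - toLp 2 (Z.V F α τ (qHalf t) h)‖ ^ 2
        ≤ C * (1 + ∑ t ∈ Finset.range N,
            ∑ i, (Z.toSeq (qHalf (t + 1)) i - Z.toSeq (qHalf t) i) ^ 2) := by
  obtain ⟨A, hA0, hA⟩ := Z.exists_sum_sq_W_sub_le F α hκ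
  obtain ⟨L, hL0, hL⟩ := exists_sq_apply_le F
  have aux : ∀ n : ℕ, ∃ C : ℝ, 0 ≤ C ∧ ∀ (τ γ : ℝ) (q qHalf : ℕ → I → ℝ), (∀ h, 0 ≤ τ * α h) →
      (∀ h, τ * α h ≤ 1) → Z.IsRegCFR F α τ κ γ q qHalf → ∀ h N, Z.height h < n →
      ∑ t ∈ Finset.range N,
          ‖toLp 2 (Z.V F α τ (qHalf (t + 1)) h) - toLp 2 (Z.V F α τ (qHalf t) h)‖ ^ 2
        ≤ C * (1 + ∑ t ∈ Finset.range N,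
            ∑ i, (Z.toSeq (qHalf (t + 1)) i - Z.toSeq (qHalf t) i) ^ 2) := by
    intro n
    induction n with
    | zero => exact ⟨0, le_rfl, fun _ _ _ _ _ _ _ _ _ hh => absurd hh (Nat.not_lt_zero _)⟩
    | succ n ih =>
      obtain ⟨C, hC0, hC⟩ := ih
      have hE : 0 ≤ 2 * L + 2 * Fintype.card H * (Fintype.card H * (A * (1 + C))) := by positivity
      refine ⟨Fintype.card I * (2 * L + 2 * Fintype.card H * (Fintype.card H * (A * (1 + C)))),
        by positivity, ?_⟩
      intro τ γ q qHalf h0 h1 R h N hh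
      obtain ⟨D, hD⟩ : ∃ D, D = ∑ t ∈ Finset.range N,
        ∑ i, (Z.toSeq (qHalf (t + 1)) i - Z.toSeq (qHalf t) i) ^ 2 := ⟨_, rfl⟩
      have hD0 : 0 ≤ D := by rw [hD]; positivity
      rw [← hD]
      simp only [norm_toLp_sub_sq]
      rw [Finset.sum_comm]
      have hrow : ∀ i ∈ (Finset.univ : Finset (Z.Act h)), ∑ t ∈ Finset.range N,
          (Z.V F α τ (qHalf (t + 1)) h i - Z.V F α τ (qHalf t) h i) ^ 2
          ≤ (2 * L + 2 * Fintype.card H * (Fintype.card H * (A * (1 + C)))) * (1 + D) := by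
        intro i _
        obtain ⟨ω, hω⟩ : ∃ ω : H → ℕ → ℝ, ∀ h' t, ω h' t
          = Z.W α τ (F (Z.toSeq (qHalf (t + 1)))) (qHalf (t + 1)) h'
            - Z.W α τ (F (Z.toSeq (qHalf t))) (qHalf t) h' := ⟨_, fun _ _ => rfl⟩
        have hpt : ∀ t, (Z.V F α τ (qHalf (t + 1)) h i - Z.V F α τ (qHalf t) h i) ^ 2
            ≤ 2 * (L * ∑ i, (Z.toSeq (qHalf (t + 1)) i - Z.toSeq (qHalf t) i) ^ 2)
              + 2 * (Fintype.card H
                * ∑ h' : {h' : H // Z.parent h' = some i.1}, ω h'.1 t ^ 2) := by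
          intro t
          have e : Z.V F α τ (qHalf (t + 1)) h i - Z.V F α τ (qHalf t) h i
              = F (Z.toSeq (qHalf (t + 1)) - Z.toSeq (qHalf t)) i.1
                + ∑ h' : {h' : H // Z.parent h' = some i.1}, ω h'.1 t := by
            simp only [V, hω, Finset.sum_sub_distrib, map_sub, Pi.sub_apply]
            ring
          have a1 := hL (Z.toSeq (qHalf (t + 1)) - Z.toSeq (qHalf t)) i.1
          have a2 : (∑ h' : {h' : H // Z.parent h' = some i.1}, ω h'.1 t) ^ 2
              ≤ Fintype.card H * ∑ h' : {h' : H // Z.parent h' = some i.1}, ω h'.1 t ^ 2 := by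
            refine sq_sum_le_card_mul_sum_sq.trans (mul_le_mul_of_nonneg_right ?_ (by positivity))
            rw [Finset.card_univ]
            exact_mod_cast Fintype.card_subtype_le _
          simp only [Pi.sub_apply] at a1
          rw [e]
          refine (add_sq_le).trans ?_
          linarith
        have hchild : ∑ h' : {h' : H // Z.parent h' = some i.1}, ∑ t ∈ Finset.range N, ω h'.1 t ^ 2
            ≤ Fintype.card H * (A * (1 + C) * (1 + D)) := by
          have hb : ∀ h' ∈ (Finset.univ : Finset {h' : H // Z.parent h' = some i.1}),
              ∑ t ∈ Finset.range N, ω h'.1 t ^ 2 ≤ A * (1 + C) * (1 + D) := by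
            intro h' _
            have hlt := Z.height_lt h'.2
            rw [i.2] at hlt
            have b1 := hA τ γ q qHalf h0 h1 R h'.1 N
            have b2 := hC τ γ q qHalf h0 h1 R h'.1 N (by omega)
            simp only [← hω] at b1
            refine b1.trans ?_
            rw [← hD] at b2
            rw [mul_assoc]
            refine mul_le_mul_of_nonneg_left ?_ hA0
            linarith
          refine (Finset.sum_le_card_nsmul _ _ _ hb).trans ?_
          rw [nsmul_eq_mul, Finset.card_univ]
          refine mul_le_mul_of_nonneg_right ?_ (by positivity)
          exact_mod_cast Fintype.card_subtype_le _
        refine (Finset.sum_le_sum fun t _ => hpt t).trans ?_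
        rw [Finset.sum_add_distrib, ← Finset.mul_sum, ← Finset.mul_sum, ← Finset.mul_sum,
          ← Finset.mul_sum, ← hD, Finset.sum_comm]
        have b3 := mul_le_mul_of_nonneg_left hchild
          (show (0 : ℝ) ≤ 2 * Fintype.card H by positivity)
        linarith
      refine (Finset.sum_le_card_nsmul _ _ _ hrow).trans ?_
      rw [nsmul_eq_mul, Finset.card_univ, ← mul_assoc]
      refine mul_le_mul_of_nonneg_right (mul_le_mul_of_nonneg_right ?_ hE) (by linarith)
      exact_mod_cast Fintype.card_subtype_le _
  obtain ⟨C, hC0, hC⟩ := aux Z.size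
  exact ⟨C, hC0, fun τ γ q qHalf h0 h1 R h N =>
    hC τ γ q qHalf h0 h1 R h N (Z.height_lt_size h)⟩

/-- The regularized regret of a run is bounded by the sum of the inverse stepsizes. -/
theorem IsRegCFR.regret_le {F : (I → ℝ) → I → ℝ} {α : H → ℝ} {τ κ γ B : ℝ}
    {q qHalf : ℕ → I → ℝ} (R : Z.IsRegCFR F α τ κ γ q qHalf) (hκ : 1 ≤ κ)
    (h0 : ∀ h, 0 ≤ τ * α h) (h1 : ∀ h, τ * α h ≤ 1)
    (hB : ∀ t h, ‖toLp 2 (Z.V F α τ (qHalf t) h)‖ ≤ B) {p : I → ℝ} (hp : p ∈ Z.behavioral γ)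
    (N : ℕ) :
    ∑ t ∈ Finset.range N, (F (Z.toSeq (qHalf (t + 1))) ⬝ᵥ Z.toSeq (qHalf (t + 1))
        + τ * Z.dilated α (qHalf (t + 1))
        - (F (Z.toSeq (qHalf (t + 1))) ⬝ᵥ Z.toSeq p + τ * Z.dilated α p))
      ≤ (5 + B) * ∑ h, Z.stepsize F α τ κ qHalf h (N + 1) := by
  have hm := Z.parentMass_mem_Icc (Z.toSeq_mem_Icc (mem_Icc_of_mem_behavioral hp))
  simp only [Z.regret_decomposition]
  rw [Finset.sum_comm, Finset.mul_sum]
  refine Finset.sum_le_sum fun h _ => ?_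
  rw [← Finset.mul_sum]
  have hB0 : 0 ≤ B := (norm_nonneg _).trans (hB 0 h)
  have P := R.proxRun Z hκ h (h0 h) (h1 h) fun t => hB t h
  have hr := P.regret_le (x := toLp 2 (Z.slice p h)) (hp h) N
  have hl : 0 ≤ (5 + B) * Z.stepsize F α τ κ qHalf h (N + 1) :=
    mul_nonneg (by linarith) (Real.sqrt_nonneg _)
  have hr2 : ∑ t ∈ Finset.range N, (Z.cfLoss α τ (F (Z.toSeq (qHalf (t + 1)))) (qHalf (t + 1)) h
      ⬝ᵥ (Z.slice (qHalf (t + 1)) h - Z.slice p h)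
        + τ * α h * (euclReg (Z.slice (qHalf (t + 1)) h) - euclReg (Z.slice p h)))
      ≤ (5 + B) * Z.stepsize F α τ κ qHalf h (N + 1) := by
    refine le_trans (le_of_eq (Finset.sum_congr rfl fun t _ => ?_)) hr
    rw [EuclideanSpace.real_norm_sq_eq, EuclideanSpace.real_norm_sq_eq, ← toLp_sub,
      EuclideanSpace.inner_toLp_toLp, dotProduct_comm]
    rfl
  exact (mul_le_mul_of_nonneg_left hr2 (hm h).1).trans (mul_le_of_le_one_left hl (hm h).2)

/-- The regularized game on the perturbed treeplex has an equilibrium, provided that a run of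
Reg-CFR exists: the inverse stepsizes, and thereby the regrets, grow at most like `√N`. -/
theorem IsRegCFR.exists_equilibrium {F : (I → ℝ) →ₗ[ℝ] (I → ℝ)} (hF : ∀ z, F z ⬝ᵥ z = 0)
    {α : H → ℝ} (hα : ∀ h, 0 < α h) {τ κ γ : ℝ} {q qHalf : ℕ → I → ℝ} (hτ : 0 < τ) (hκ : 1 ≤ κ)
    (h1 : ∀ h, τ * α h ≤ 1) (R : Z.IsRegCFR F α τ κ γ q qHalf) :
    ∃ q' ∈ Z.behavioral γ, ∀ p ∈ Z.behavioral γ,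
      τ * ∑ h, Z.parentMass (Z.toSeq p) h * (α h * ∑ i : Z.Act h, (p i.1 - q' i.1) ^ 2)
        ≤ F (Z.toSeq q') ⬝ᵥ Z.toSeq p + τ * Z.dilated α p
          - (F (Z.toSeq q') ⬝ᵥ Z.toSeq q' + τ * Z.dilated α q') := by
  obtain ⟨B, hB0, hB⟩ := Z.exists_bounds F α
  have h0 : ∀ h, 0 ≤ τ * α h := fun h => mul_nonneg hτ.le (hα h).le
  have hBt : ∀ t h, ‖toLp 2 (Z.V F α τ (qHalf t) h)‖ ≤ B := fun t h =>
    (hB τ h0 h1 (qHalf t) (R.half_mem_Icc Z t) h).1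
  refine Z.exists_equilibrium hF hα hτ (p := fun t => qHalf (t + 1)) (R.mem_behavioral_half Z)
    (r := fun N => (5 + B) * (Fintype.card H * √(κ + (2 * B) ^ 2)) / √((N : ℝ) + 1)) ?_ ?_
  · refine tendsto_const_nhds.div_atTop (Real.tendsto_sqrt_atTop.comp ?_)
    exact Filter.tendsto_atTop_add_const_right _ _ tendsto_natCast_atTop_atTop
  · intro p hp N
    refine (R.regret_le Z hκ h0 h1 hBt hp (N + 1)).trans ?_
    have hN : (0 : ℝ) < N + 1 := by positivity
    have hs : √((N : ℝ) + 1) ≠ 0 := (Real.sqrt_pos.2 hN).ne'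
    have hstep : ∀ h ∈ (Finset.univ : Finset H),
        Z.stepsize F α τ κ qHalf h (N + 1 + 1) ≤ √(κ + (2 * B) ^ 2) * √((N : ℝ) + 1) := by
      intro h _
      rw [← Real.sqrt_mul (by positivity)]
      refine Real.le_sqrt_of_sq_le ?_
      rw [Z.stepsize_sq F α τ hκ]
      have hb : ∀ t ∈ Finset.range (N + 1),
          ‖toLp 2 (Z.V F α τ (qHalf (t + 1)) h) - toLp 2 (Z.V F α τ (qHalf t) h)‖ ^ 2
            ≤ (2 * B) ^ 2 := fun t _ => pow_le_pow_left₀ (norm_nonneg _)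
        ((norm_sub_le _ _).trans (by linarith [hBt t h, hBt (t + 1) h])) 2
      have hsum := Finset.sum_le_card_nsmul _ _ _ hb
      rw [nsmul_eq_mul, Finset.card_range] at hsum
      push_cast at hsum
      have hκN : 0 ≤ κ * N := mul_nonneg (by linarith) (Nat.cast_nonneg N)
      linarith
    have hsum := Finset.sum_le_card_nsmul _ _ _ hstep
    rw [nsmul_eq_mul, Finset.card_univ] at hsum
    refine (mul_le_mul_of_nonneg_left hsum (by linarith : 0 ≤ 5 + B)).trans_eq ?_
    have e : (N + 1 : ℝ) = √((N : ℝ) + 1) * √((N : ℝ) + 1) := (Real.mul_self_sqrt hN.le).symm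
    rw [mul_div_assoc']
    rw [eq_div_iff hs]
    conv_rhs => rw [e]
    ring

/-- The squared distances of the iterates to the regularized equilibrium sum to `O(τ⁻²)`, with a
constant that does not depend on the perturbation. -/
theorem exists_sum_sq_le {F : (I → ℝ) →ₗ[ℝ] (I → ℝ)} (hF : ∀ z, F z ⬝ᵥ z = 0)
    {α : H → ℝ} (hα : ∀ h, 0 < α h) {κ : ℝ} (hκ : 1 ≤ κ) :
    ∃ C : ℝ, 0 ≤ C ∧ ∀ (τ γ : ℝ) (q qHalf : ℕ → I → ℝ), 0 < τ → τ ≤ 1 → (∀ h, τ * α h ≤ 1) →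
      Z.IsRegCFR F α τ κ γ q qHalf → ∃ q' ∈ Z.behavioral γ,
        (∀ p ∈ Z.behavioral γ, τ * Z.dilated α q'
          ≤ F (Z.toSeq q') ⬝ᵥ Z.toSeq p + τ * Z.dilated α p) ∧
        ∀ N, ∑ t ∈ Finset.range N, ∑ i, (Z.toSeq (q (t + 1)) i - Z.toSeq q' i) ^ 2
          ≤ C / τ ^ 2 := by
  obtain ⟨B, hB0, hB⟩ := Z.exists_bounds F α
  obtain ⟨A, hA0, hA⟩ := Z.exists_sum_sq_V_sub_le F α hκ
  obtain ⟨a, ha0, ha⟩ : ∃ a : ℝ, 0 < a ∧ ∀ h, a ≤ α h := by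
    rcases isEmpty_or_nonempty H with hH | hH
    · exact ⟨1, one_pos, fun h => hH.elim h⟩
    · obtain ⟨h, hh⟩ := Finite.exists_min α
      exact ⟨α h, hα h, hh⟩
  obtain ⟨c, hc⟩ : ∃ c : ℝ, c = Fintype.card I * (Z.size : ℝ) ^ 2 := ⟨_, rfl⟩
  have hc0 : 0 ≤ c := by rw [hc]; positivity
  obtain ⟨A₁, hA₁⟩ : ∃ x : ℝ, x = A * (1 + 2 * Fintype.card I + 4 * c) := ⟨_, rfl⟩
  have hA₁0 : 0 ≤ A₁ := by rw [hA₁]; positivity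
  obtain ⟨K, hK⟩ : ∃ x : ℝ, x = (5 + B) * (Fintype.card H * √(κ + A₁)) / a + 1 := ⟨_, rfl⟩
  have hK0 : 0 ≤ K := by rw [hK]; positivity
  obtain ⟨K₂, hK₂⟩ : ∃ x : ℝ, x = 2 * (c * (9 * (Fintype.card H * A₁))) + 2 * c
      + Fintype.card I := ⟨_, rfl⟩
  have hK₂0 : 0 ≤ K₂ := by rw [hK₂]; positivity
  refine ⟨K₂ * K ^ 2, by positivity, ?_⟩
  intro τ γ q qHalf hτ hτ1 h1 R
  have h0 : ∀ h, 0 ≤ τ * α h := fun h => mul_nonneg hτ.le (hα h).le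
  have hBt : ∀ t h, ‖toLp 2 (Z.V F α τ (qHalf t) h)‖ ≤ B := fun t h =>
    (hB τ h0 h1 (qHalf t) (R.half_mem_Icc Z t) h).1
  obtain ⟨q', hq', hgrow⟩ := R.exists_equilibrium Z hF hα hτ hκ h1
  have hq'01 := mem_Icc_of_mem_behavioral hq'
  have hskew : ∀ z z', F z ⬝ᵥ z' = -(F z' ⬝ᵥ z) := by
    intro z z'
    have := hF (z + z')
    rw [map_add, add_dotProduct, dotProduct_add, dotProduct_add, hF, hF] at this
    linarith
  have hm : ∀ t h, Z.parentMass (Z.toSeq (qHalf t)) h ∈ Set.Icc (0 : ℝ) 1 := fun t =>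
    Z.parentMass_mem_Icc (Z.toSeq_mem_Icc (R.half_mem_Icc Z t))
  have hsq : ∀ p p' : I → ℝ, (∀ i, p i ∈ Set.Icc (0 : ℝ) 1) → (∀ i, p' i ∈ Set.Icc (0 : ℝ) 1) →
      ∑ i, (Z.toSeq p i - Z.toSeq p' i) ^ 2 ≤ Fintype.card I := by
    intro p p' hp hp'
    refine sum_sq_le_card (z := fun i => Z.toSeq p i - Z.toSeq p' i) fun i => ?_
    have e1 := Z.toSeq_mem_Icc hp i
    have e2 := Z.toSeq_mem_Icc hp' i
    rw [abs_le]
    constructor <;> linarith [e1.1, e1.2, e2.1, e2.2]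
  refine ⟨q', hq', fun p hp => ?_, ?_⟩
  · have hmp := Z.parentMass_mem_Icc (Z.toSeq_mem_Icc (mem_Icc_of_mem_behavioral hp))
    have hnn : 0 ≤ τ * ∑ h, Z.parentMass (Z.toSeq p) h
        * (α h * ∑ i : Z.Act h, (p i.1 - q' i.1) ^ 2) :=
      mul_nonneg hτ.le (Finset.sum_nonneg fun h _ => mul_nonneg (hmp h).1
        (mul_nonneg (hα h).le (Finset.sum_nonneg fun _ _ => sq_nonneg _)))
    have := hgrow p hp
    rw [hF] at this
    linarith
  -- the distance of the iterates, weighted with their own reach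
  obtain ⟨s, hs⟩ : ∃ s : ℕ → ℝ, ∀ t, s t = ∑ h, Z.parentMass (Z.toSeq (qHalf (t + 1))) h
    * ∑ i : Z.Act h, (qHalf (t + 1) i.1 - q' i.1) ^ 2 := ⟨_, fun _ => rfl⟩
  have hs0 : ∀ t, 0 ≤ s t := fun t => by
    rw [hs]
    exact Finset.sum_nonneg fun h _ => mul_nonneg (hm _ h).1
      (Finset.sum_nonneg fun _ _ => sq_nonneg _)
  have hdist : ∀ t, ∑ i, (Z.toSeq (qHalf (t + 1)) i - Z.toSeq q' i) ^ 2 ≤ c * s t := fun t => by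
    rw [hs, hc]
    exact Z.sum_sq_toSeq_sub_le (R.half_mem_Icc Z _) hq'01
  have hvar : ∀ N, ∑ t ∈ Finset.range N,
      ∑ i, (Z.toSeq (qHalf (t + 1)) i - Z.toSeq (qHalf t) i) ^ 2
      ≤ 2 * Fintype.card I + 4 * c * ∑ t ∈ Finset.range N, s t := by
    intro N
    obtain ⟨d, hd⟩ : ∃ d : ℕ → ℝ, ∀ t, d t = ∑ i, (Z.toSeq (qHalf t) i - Z.toSeq q' i) ^ 2 :=
      ⟨_, fun _ => rfl⟩
    have hd0 : ∀ t, 0 ≤ d t := fun t => by rw [hd]; positivity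
    have e1 : ∀ t, ∑ i, (Z.toSeq (qHalf (t + 1)) i - Z.toSeq (qHalf t) i) ^ 2
        ≤ 2 * d (t + 1) + 2 * d t := by
      intro t
      rw [hd, hd, Finset.mul_sum, Finset.mul_sum, ← Finset.sum_add_distrib]
      refine Finset.sum_le_sum fun i _ => ?_
      have := add_sq_le (a := Z.toSeq (qHalf (t + 1)) i - Z.toSeq q' i)
        (b := Z.toSeq q' i - Z.toSeq (qHalf t) i)
      rw [sub_add_sub_cancel, ← neg_sub (Z.toSeq (qHalf t) i), neg_sq] at this
      linarith
    have e2 : ∑ t ∈ Finset.range N, d (t + 1) ≤ c * ∑ t ∈ Finset.range N, s t := by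
      rw [Finset.mul_sum]
      refine Finset.sum_le_sum fun t _ => ?_
      rw [hd]
      exact hdist t
    have e3 : ∑ t ∈ Finset.range N, d t ≤ Fintype.card I + ∑ t ∈ Finset.range N, d (t + 1) := by
      have f1 : ∑ t ∈ Finset.range N, d t ≤ ∑ t ∈ Finset.range (N + 1), d t := by
        rw [Finset.sum_range_succ]; linarith [hd0 N]
      have f2 : d 0 ≤ Fintype.card I := by
        rw [hd]; exact hsq _ _ (R.half_mem_Icc Z 0) hq'01
      rw [Finset.sum_range_succ'] at f1
      linarith
    refine (Finset.sum_le_sum fun t _ => e1 t).trans ?_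
    rw [Finset.sum_add_distrib, ← Finset.mul_sum, ← Finset.mul_sum]
    linarith
  have hw : ∀ h N, ∑ t ∈ Finset.range N,
      ‖toLp 2 (Z.V F α τ (qHalf (t + 1)) h) - toLp 2 (Z.V F α τ (qHalf t) h)‖ ^ 2
      ≤ A₁ * (1 + ∑ t ∈ Finset.range N, s t) := by
    intro h N
    refine (hA τ γ q qHalf h0 h1 R h N).trans ?_
    rw [hA₁, mul_assoc]
    refine mul_le_mul_of_nonneg_left ?_ hA0
    have hS : 0 ≤ ∑ t ∈ Finset.range N, s t := Finset.sum_nonneg fun t _ => hs0 t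
    have := hvar N
    have := mul_nonneg (show (0 : ℝ) ≤ 1 + 2 * Fintype.card I by positivity) hS
    linarith
  have hS : ∀ N, 1 + ∑ t ∈ Finset.range N, s t ≤ K ^ 2 / τ ^ 2 := by
    intro N
    obtain ⟨S, hSdef⟩ : ∃ S, S = ∑ t ∈ Finset.range N, s t := ⟨_, rfl⟩
    have hS0 : 0 ≤ S := by rw [hSdef]; exact Finset.sum_nonneg fun t _ => hs0 t
    rw [← hSdef]
    have hlam : ∀ h ∈ (Finset.univ : Finset H),
        Z.stepsize F α τ κ qHalf h (N + 1) ≤ √(κ + A₁) * √(1 + S) := by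
      intro h _
      rw [← Real.sqrt_mul (by positivity)]
      refine Real.le_sqrt_of_sq_le ?_
      rw [Z.stepsize_sq F α τ hκ]
      have := hw h N
      rw [← hSdef] at this
      have := mul_nonneg (zero_le_one.trans hκ) hS0
      linarith
    have hsum := Finset.sum_le_card_nsmul _ _ _ hlam
    rw [nsmul_eq_mul, Finset.card_univ] at hsum
    have hreg := R.regret_le Z hκ h0 h1 hBt hq' N
    have hlow : ∀ t, τ * (a * s t) ≤ F (Z.toSeq (qHalf (t + 1))) ⬝ᵥ Z.toSeq (qHalf (t + 1))
        + τ * Z.dilated α (qHalf (t + 1))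
        - (F (Z.toSeq (qHalf (t + 1))) ⬝ᵥ Z.toSeq q' + τ * Z.dilated α q') := by
      intro t
      have g1 := hgrow _ (R.mem_behavioral_half Z t)
      rw [hF, hskew] at g1
      rw [hF]
      have g2 : a * s t ≤ ∑ h, Z.parentMass (Z.toSeq (qHalf (t + 1))) h
          * (α h * ∑ i : Z.Act h, (qHalf (t + 1) i.1 - q' i.1) ^ 2) := by
        rw [hs, Finset.mul_sum]
        refine Finset.sum_le_sum fun h _ => ?_
        rw [mul_left_comm]
        refine mul_le_mul_of_nonneg_left ?_ (hm _ h).1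
        exact mul_le_mul_of_nonneg_right (ha h) (Finset.sum_nonneg fun _ _ => sq_nonneg _)
      have g3 := mul_le_mul_of_nonneg_left g2 hτ.le
      linarith
    have hmain : τ * (a * S) ≤ (5 + B) * (Fintype.card H * √(κ + A₁)) * √(1 + S) := by
      calc τ * (a * S) = ∑ t ∈ Finset.range N, τ * (a * s t) := by
            rw [hSdef, Finset.mul_sum, Finset.mul_sum]
        _ ≤ _ := Finset.sum_le_sum fun t _ => hlow t
        _ ≤ _ := hreg
        _ ≤ (5 + B) * (Fintype.card H * (√(κ + A₁) * √(1 + S))) :=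
            mul_le_mul_of_nonneg_left hsum (by linarith)
        _ = _ := by ring
    -- `τ S ≤ (K - 1) √(1 + S)` and `τ ≤ 1` give `τ √(1 + S) ≤ K`
    have hroot : 1 ≤ √(1 + S) := Real.one_le_sqrt.2 (by linarith)
    have hrootsq : √(1 + S) * √(1 + S) = 1 + S := Real.mul_self_sqrt (by linarith)
    have hτS : τ * S ≤ (K - 1) * √(1 + S) := by
      rw [hK, add_sub_cancel_right, div_mul_eq_mul_div, le_div_iff₀ ha0]
      linarith
    have hfin : τ * √(1 + S) ≤ K := by
      refine le_of_mul_le_mul_right ?_ (zero_lt_one.trans_le hroot)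
      rw [mul_assoc, hrootsq]
      linarith
    have hfin2 := pow_le_pow_left₀ (mul_nonneg hτ.le (Real.sqrt_nonneg _)) hfin 2
    rw [le_div_iff₀ (by positivity)]
    rw [mul_pow, Real.sq_sqrt (by linarith)] at hfin2
    linarith
  have hclose : ∀ t, ∑ i, (Z.toSeq (qHalf (t + 1)) i - Z.toSeq (q (t + 2)) i) ^ 2
      ≤ c * (9 * ∑ h, ‖toLp 2 (Z.V F α τ (qHalf (t + 1)) h)
        - toLp 2 (Z.V F α τ (qHalf t) h)‖ ^ 2) := by
    intro t
    have e1 := Z.sum_sq_toSeq_sub_le (R.half_mem_Icc Z (t + 1))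
      (mem_Icc_of_mem_behavioral (R.mem_behavioral Z (t + 1)))
    rw [← hc] at e1
    refine e1.trans (mul_le_mul_of_nonneg_left ?_ hc0)
    rw [Finset.mul_sum]
    refine Finset.sum_le_sum fun h _ => ?_
    have P := (R.proxRun Z hκ h (h0 h) (h1 h) fun t => hBt t h).norm_p_sub_q_le t
    have e2 := pow_le_pow_left₀ (norm_nonneg _) P 2
    rw [norm_toLp_sub_sq, mul_pow] at e2
    refine (mul_le_of_le_one_left (Finset.sum_nonneg fun _ _ => sq_nonneg _) (hm _ h).2).trans ?_
    refine e2.trans (le_of_eq ?_)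
    norm_num
  intro N
  refine le_trans ?_ (?_ : K₂ * (1 + ∑ t ∈ Finset.range N, s t) ≤ _)
  · have hpt : ∀ t, ∑ i, (Z.toSeq (q (t + 2)) i - Z.toSeq q' i) ^ 2
        ≤ 2 * (c * (9 * ∑ h, ‖toLp 2 (Z.V F α τ (qHalf (t + 1)) h)
          - toLp 2 (Z.V F α τ (qHalf t) h)‖ ^ 2)) + 2 * (c * s t) := by
      intro t
      refine le_trans ?_ (add_le_add (mul_le_mul_of_nonneg_left (hclose t) zero_le_two)
        (mul_le_mul_of_nonneg_left (hdist t) zero_le_two))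
      rw [Finset.mul_sum, Finset.mul_sum, ← Finset.sum_add_distrib]
      refine Finset.sum_le_sum fun i _ => ?_
      have := add_sq_le (a := Z.toSeq (q (t + 2)) i - Z.toSeq (qHalf (t + 1)) i)
        (b := Z.toSeq (qHalf (t + 1)) i - Z.toSeq q' i)
      rw [sub_add_sub_cancel, ← neg_sub (Z.toSeq (qHalf (t + 1)) i) (Z.toSeq (q (t + 2)) i),
        neg_sq] at this
      linarith
    have hfirst := hsq (q 1) q' (mem_Icc_of_mem_behavioral (R.mem_behavioral Z 0)) hq'01
    have hSN : 0 ≤ ∑ t ∈ Finset.range N, s t := Finset.sum_nonneg fun t _ => hs0 t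
    have hws : ∑ t ∈ Finset.range N, ∑ h, ‖toLp 2 (Z.V F α τ (qHalf (t + 1)) h)
        - toLp 2 (Z.V F α τ (qHalf t) h)‖ ^ 2
        ≤ Fintype.card H * (A₁ * (1 + ∑ t ∈ Finset.range N, s t)) := by
      rw [Finset.sum_comm]
      refine (Finset.sum_le_card_nsmul _ _ _ fun h _ => hw h N).trans_eq ?_
      rw [nsmul_eq_mul, Finset.card_univ]
    have hshift : ∑ t ∈ Finset.range N, ∑ i, (Z.toSeq (q (t + 1)) i - Z.toSeq q' i) ^ 2
        ≤ ∑ t ∈ Finset.range (N + 1), ∑ i, (Z.toSeq (q (t + 1)) i - Z.toSeq q' i) ^ 2 := by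
      rw [Finset.sum_range_succ]
      exact le_add_of_nonneg_right (Finset.sum_nonneg fun _ _ => sq_nonneg _)
    refine hshift.trans ?_
    rw [Finset.sum_range_succ']
    have htail := Finset.sum_le_sum fun t (_ : t ∈ Finset.range N) => hpt t
    rw [Finset.sum_add_distrib, ← Finset.mul_sum, ← Finset.mul_sum, ← Finset.mul_sum,
      ← Finset.mul_sum, ← Finset.mul_sum] at htail
    refine (add_le_add htail hfirst).trans ?_
    have k1 := mul_le_mul_of_nonneg_left hws (show 0 ≤ 18 * c by linarith)
    have k2 : 0 ≤ (Fintype.card I : ℝ) * ∑ t ∈ Finset.range N, s t := by positivity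
    rw [hK₂]
    linarith
  · rw [mul_div_assoc]
    exact mul_le_mul_of_nonneg_left (hS N) hK₂0

end Treeplex

/-! ### The duality gap -/

section Game

variable {IX IY : Type} [Fintype IX] [Fintype IY]

/-- `gameOp A` as a linear map. -/
def gameLin (A : Matrix IX IY ℝ) : (IX ⊕ IY → ℝ) →ₗ[ℝ] (IX ⊕ IY → ℝ) where
  toFun := gameOp A
  map_add' z z' := by
    funext i
    rcases i with i | i
    · change (A.mulVec (z ∘ Sum.inr + z' ∘ Sum.inr)) i = _
      rw [Matrix.mulVec_add]
      rfl
    · change (-(A.transpose.mulVec (z ∘ Sum.inl + z' ∘ Sum.inl))) i = _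
      rw [Matrix.mulVec_add, neg_add]
      rfl
  map_smul' c z := by
    funext i
    rcases i with i | i
    · change (A.mulVec (c • (z ∘ Sum.inr))) i = _
      rw [Matrix.mulVec_smul]
      rfl
    · change (-(A.transpose.mulVec (c • (z ∘ Sum.inl)))) i = _
      rw [Matrix.mulVec_smul, ← smul_neg]
      rfl

theorem gameLin_dotProduct_self (A : Matrix IX IY ℝ) (z : IX ⊕ IY → ℝ) :
    gameLin A z ⬝ᵥ z = 0 := by
  have e : gameLin A z ⬝ᵥ z = A.mulVec (z ∘ Sum.inr) ⬝ᵥ (z ∘ Sum.inl)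
      + (-(A.transpose.mulVec (z ∘ Sum.inl))) ⬝ᵥ (z ∘ Sum.inr) := Fintype.sum_sum_type _
  rw [e, neg_dotProduct, Matrix.mulVec_transpose, ← Matrix.dotProduct_mulVec, dotProduct_comm,
    add_neg_cancel]

end Game

namespace Treeplex

variable {H I : Type} [Fintype H] [DecidableEq H] [Fintype I] [DecidableEq I] (Z : Treeplex H I)

theorem dotProduct_le_of_mem_Icc {v z : I → ℝ} {b : ℝ} (hv : ∀ i, |v i| ≤ b)
    (hz : ∀ i, z i ∈ Set.Icc (0 : ℝ) 1) : v ⬝ᵥ z ≤ Fintype.card I * b := by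
  refine (Finset.sum_le_card_nsmul _ _ b fun i _ => ?_).trans_eq (by
    rw [nsmul_eq_mul, Finset.card_univ])
  have hb : 0 ≤ b := (abs_nonneg _).trans (hv i)
  refine (le_abs_self _).trans ?_
  rw [abs_mul, abs_of_nonneg (hz i).1]
  exact (mul_le_of_le_one_right (abs_nonneg _) (hz i).2).trans (hv i)

/-- The gap is bounded uniformly, and near a regularized equilibrium it is at most the
regularization plus a multiple of the distance. -/
theorem exists_gap_le {F : (I → ℝ) →ₗ[ℝ] (I → ℝ)} (hF : ∀ z, F z ⬝ᵥ z = 0) {α : H → ℝ}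
    (hα : ∀ h, 0 < α h) :
    ∃ G : ℝ, 0 ≤ G ∧ ∀ (γ : ℝ) (q p : I → ℝ), q ∈ Z.behavioral γ → p ∈ Z.behavioral γ →
      F (Z.toSeq q) ⬝ᵥ (Z.toSeq q - Z.toSeq p) ≤ G ∧
      ∀ (τ : ℝ) (q' : I → ℝ), 0 ≤ τ → q' ∈ Z.behavioral γ →
        (τ * Z.dilated α q' ≤ F (Z.toSeq q') ⬝ᵥ Z.toSeq p + τ * Z.dilated α p) →
        F (Z.toSeq q) ⬝ᵥ (Z.toSeq q - Z.toSeq p)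
          ≤ τ * ∑ h, α h + G * √(∑ i, (Z.toSeq q i - Z.toSeq q' i) ^ 2) := by
  obtain ⟨L, hL0, hL⟩ := exists_sq_apply_le F
  have hF' : ∀ z i, |F z i| ≤ √L * √(∑ j, z j ^ 2) := by
    intro z i
    rw [← Real.sqrt_mul hL0]
    exact Real.abs_le_sqrt (hL z i)
  refine ⟨Fintype.card I * (√L * √(Fintype.card I)) + Fintype.card I * √L, by positivity, ?_⟩
  intro γ q p hq hp
  have hp01 := Z.toSeq_mem_Icc (mem_Icc_of_mem_behavioral hp)
  have hq01 := Z.toSeq_mem_Icc (mem_Icc_of_mem_behavioral hq)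
  have e : F (Z.toSeq q) ⬝ᵥ (Z.toSeq q - Z.toSeq p) = F (-Z.toSeq q) ⬝ᵥ Z.toSeq p := by
    rw [dotProduct_sub, hF, map_neg, neg_dotProduct, zero_sub]
  rw [e]
  constructor
  · have h1 : ∀ i, |F (-Z.toSeq q) i| ≤ √L * √(Fintype.card I) := by
      intro i
      refine (hF' _ i).trans (mul_le_mul_of_nonneg_left (Real.sqrt_le_sqrt ?_) (Real.sqrt_nonneg _))
      refine sum_sq_le_card fun j => ?_
      rw [Pi.neg_apply, abs_neg, abs_of_nonneg (hq01 j).1]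
      exact (hq01 j).2
    exact (dotProduct_le_of_mem_Icc h1 hp01).trans (le_add_of_nonneg_right (by positivity))
  · intro τ q' hτ hq' hopt
    have h1 := dotProduct_le_of_mem_Icc (hF' (Z.toSeq q' - Z.toSeq q)) hp01
    have h2 : ∑ j, (Z.toSeq q' - Z.toSeq q) j ^ 2 = ∑ i, (Z.toSeq q i - Z.toSeq q' i) ^ 2 :=
      Finset.sum_congr rfl fun i _ => by rw [Pi.sub_apply]; ring
    have e2 : F (-Z.toSeq q) ⬝ᵥ Z.toSeq p
        = F (Z.toSeq q' - Z.toSeq q) ⬝ᵥ Z.toSeq p - F (Z.toSeq q') ⬝ᵥ Z.toSeq p := by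
      rw [map_sub, sub_dotProduct, map_neg, neg_dotProduct]
      ring
    rw [h2] at h1
    have h3 := mul_le_mul_of_nonneg_left (Z.dilated_mem_Icc hα hp).2 hτ
    have h4 := mul_nonneg hτ (Z.dilated_mem_Icc hα hq').1
    have h5 : 0 ≤ Fintype.card I * (√L * √(Fintype.card I))
        * √(∑ i, (Z.toSeq q i - Z.toSeq q' i) ^ 2) := by positivity
    rw [e2]
    linarith

end Treeplex

theorem dualityGap_le {IX IY : Type} [Fintype IX] [Fintype IY] (A : Matrix IX IY ℝ)
    {S : Set (IX ⊕ IY → ℝ)} {z : IX ⊕ IY → ℝ} {b : ℝ} (hb : 0 ≤ b)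
    (h : ∀ z' ∈ S, gameOp A z ⬝ᵥ (z - z') ≤ b) : dualityGap A S z ≤ b := by
  refine Real.sSup_le ?_ hb
  rintro _ ⟨z', hz', rfl⟩
  exact h z' hz'

theorem corollary1
    {HX IX HY IY : Type} [Fintype HX] [DecidableEq HX] [Fintype IX] [DecidableEq IX]
    [Fintype HY] [DecidableEq HY] [Fintype IY] [DecidableEq IY]
    (X : Treeplex HX IX) (Y : Treeplex HY IY) (A : Matrix IX IY ℝ)
    (α : HX ⊕ HY → ℝ) (hα : ∀ h, 0 < α h) :
    ∃ c₂ : ℝ, 0 < c₂ ∧ ∀ c₁ : ℝ, 0 < c₁ → c₁ ≤ c₂ → ∀ κ : ℝ, 1 ≤ κ →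
      -- original game: best-iterate convergence at the rate `T^(-1/4)`
      (∃ C : ℝ, 0 < C ∧ ∀ ε τ : ℝ, 0 < ε → c₁ * ε ≤ τ → τ ≤ c₂ * ε →
        ∀ q qHalf : ℕ → IX ⊕ IY → ℝ,
          (X.prod Y).IsRegCFR (gameOp A) α τ κ 0 q qHalf →
          ∀ T : ℕ, 1 ≤ T → C * (T : ℝ) ^ (-(1 / 4) : ℝ) ≤ ε →
            ∃ t ∈ Finset.Icc 1 T,
              dualityGap A (X.prod Y).carrier ((X.prod Y).toSeq (q t)) ≤ ε) ∧
      -- perturbed games: asymptotic last-iterate convergence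
      (∀ γ : ℝ, 0 < γ → (∀ h, γ * Fintype.card ((X.prod Y).Act h) ≤ 1) →
        ∀ ε τ : ℝ, 0 < ε → c₁ * ε ≤ τ → τ ≤ c₂ * ε →
        ∀ q qHalf : ℕ → IX ⊕ IY → ℝ,
          (X.prod Y).IsRegCFR (gameOp A) α τ κ γ q qHalf →
          ∃ T₀ : ℕ, ∀ t : ℕ, T₀ ≤ t →
            dualityGap A ((X.prod Y).perturbed γ) ((X.prod Y).toSeq (q t)) ≤ ε) := by
  obtain ⟨G, hG0, hG⟩ := (X.prod Y).exists_gap_le (gameLin_dotProduct_self A) hα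
  have hsum : 0 ≤ ∑ h, α h := Finset.sum_nonneg fun h _ => (hα h).le
  have hle : ∀ h, α h ≤ ∑ h, α h := fun h =>
    Finset.single_le_sum (fun h _ => (hα h).le) (Finset.mem_univ h)
  obtain ⟨c₂, hc₂⟩ : ∃ x : ℝ, x = 1 / (2 * (1 + G) * (1 + ∑ h, α h)) := ⟨_, rfl⟩
  have hden : 0 < 2 * (1 + G) * (1 + ∑ h, α h) := by positivity
  have hc₂0 : 0 < c₂ := by rw [hc₂]; positivity
  have hc₂eq : c₂ * (2 * (1 + G) * (1 + ∑ h, α h)) = 1 := by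
    rw [hc₂, one_div_mul_cancel hden.ne']
  refine ⟨c₂, hc₂0, ?_⟩
  intro c₁ hc₁ _ κ hκ
  obtain ⟨C, hC0, hC⟩ := (X.prod Y).exists_sum_sq_le (gameLin_dotProduct_self A) hα hκ
  -- targets above the bound `G` for all gaps are met trivially, so `τ` may be taken to be small
  have hsmall : ∀ ε τ : ℝ, 0 < ε → ε ≤ G → τ ≤ c₂ * ε → τ ≤ 1 ∧ ∀ h, τ * α h ≤ 1 := by
    intro ε τ hε hεG hτ
    have p1 := mul_nonneg hc₂0.le hG0
    have p2 := mul_nonneg hc₂0.le hsum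
    have p3 := mul_nonneg p1 hsum
    have p4 := mul_le_mul_of_nonneg_left hεG hc₂0.le
    refine ⟨by linarith, fun h => ?_⟩
    have q1 := mul_le_mul_of_nonneg_right (hτ.trans p4) (hα h).le
    have q2 := mul_le_mul_of_nonneg_left (hle h) p1
    linarith
  have hhalf : ∀ ε τ : ℝ, 0 < ε → τ ≤ c₂ * ε → τ * ∑ h, α h ≤ ε / 2 := by
    intro ε τ hε hτ
    have q1 := mul_le_mul_of_nonneg_right hτ hsum
    have p1 := mul_nonneg hc₂0.le hG0
    have q2 : c₂ * ∑ h, α h ≤ 1 / 2 := by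
      have := mul_nonneg p1 hsum
      linarith
    have q3 := mul_le_mul_of_nonneg_right q2 hε.le
    linarith
  constructor
  · refine ⟨1 + 2 * (G * √C) / c₁, by positivity, ?_⟩
    intro ε τ hε hτ1 hτ2 q qHalf R T hT hCT
    have hτ : 0 < τ := (mul_pos hc₁ hε).trans_le hτ1
    have hcar : ∀ z ∈ (X.prod Y).carrier, ∃ p ∈ (X.prod Y).behavioral 0,
        (X.prod Y).toSeq p = z := fun z hz =>
      (X.prod Y).exists_behavioral (R.mem_behavioral _ 0) hz fun i => by
        rw [zero_mul]; exact (X.prod Y).carrier_nonneg hz i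
    rcases le_or_gt G ε with hGε | hGε
    · refine ⟨1, Finset.mem_Icc.2 ⟨le_rfl, hT⟩, dualityGap_le A hε.le fun z' hz' => ?_⟩
      obtain ⟨p, hp, rfl⟩ := hcar z' hz'
      exact (hG 0 _ p (R.mem_behavioral _ 0) hp).1.trans hGε
    obtain ⟨hτ3, hτα⟩ := hsmall ε τ hε hGε.le hτ2
    obtain ⟨q', hq', hopt, hdist⟩ := hC τ 0 q qHalf hτ hτ3 hτα R
    have hT0 : (0 : ℝ) < T := by exact_mod_cast hT
    obtain ⟨t, ht, htle⟩ : ∃ t ∈ Finset.range T,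
        ∑ i, ((X.prod Y).toSeq (q (t + 1)) i - (X.prod Y).toSeq q' i) ^ 2 ≤ C / τ ^ 2 / T := by
      refine Finset.exists_le_of_sum_le (Finset.nonempty_range_iff.2 (by omega)) ?_
      rw [Finset.sum_const, Finset.card_range, nsmul_eq_mul, mul_div_cancel₀ _ hT0.ne']
      exact hdist T
    refine ⟨t + 1, Finset.mem_Icc.2 ⟨by omega, by have := Finset.mem_range.1 ht; omega⟩,
      dualityGap_le A hε.le fun z' hz' => ?_⟩
    obtain ⟨p, hp, rfl⟩ := hcar z' hz'
    refine ((hG 0 _ p (R.mem_behavioral _ t) hp).2 τ q' hτ.le hq' (hopt p hp)).trans ?_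
    have h1 := hhalf ε τ hε hτ2
    -- with `r = T^(-1/4)` the distance is at most `√C r² / τ`, where `r ≤ ε / C'`, `τ ≥ c₁ ε`
    obtain ⟨r, hr⟩ : ∃ r : ℝ, r = (T : ℝ) ^ (-(1 / 4) : ℝ) := ⟨_, rfl⟩
    rw [← hr] at hCT
    have hr0 : 0 ≤ r := by rw [hr]; positivity
    have hr4 : r ^ 4 = 1 / T := by
      rw [hr, ← Real.rpow_natCast, ← Real.rpow_mul hT0.le]
      norm_num
      rw [Real.rpow_neg_one]
    have hroot : √(∑ i, ((X.prod Y).toSeq (q (t + 1)) i - (X.prod Y).toSeq q' i) ^ 2)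
        ≤ √C * r ^ 2 / τ := by
      refine Real.sqrt_le_iff.2 ⟨by positivity, htle.trans_eq ?_⟩
      rw [div_pow, mul_pow, Real.sq_sqrt hC0, ← pow_mul, hr4]
      ring
    have hk : 0 ≤ 2 * (G * √C) / c₁ := by positivity
    have hr1 : r ≤ ε := by
      have := mul_nonneg hk hr0
      linarith
    have hr2 : 2 * (G * √C) * r ≤ c₁ * ε := by
      have : 2 * (G * √C) / c₁ * r ≤ ε := by linarith
      rw [div_mul_eq_mul_div, div_le_iff₀ hc₁] at this
      linarith
    have h2 : G * (√C * r ^ 2 / τ) ≤ ε / 2 := by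
      rw [mul_div_assoc', div_le_iff₀ hτ]
      have s1 := mul_le_mul_of_nonneg_right hr2 hr0
      have s2 := mul_le_mul_of_nonneg_left hr1 (mul_pos hc₁ hε).le
      have s3 := mul_le_mul_of_nonneg_right hτ1 hε.le
      linarith
    have h3 := mul_le_mul_of_nonneg_left hroot hG0
    linarith
  · intro γ _ _ ε τ hε hτ1 hτ2 q qHalf R
    have hτ : 0 < τ := (mul_pos hc₁ hε).trans_le hτ1
    have hcar : ∀ z ∈ (X.prod Y).perturbed γ, ∃ p ∈ (X.prod Y).behavioral γ,
        (X.prod Y).toSeq p = z := fun z hz =>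
      (X.prod Y).exists_behavioral (R.mem_behavioral _ 0) hz.1 hz.2
    rcases le_or_gt G ε with hGε | hGε
    · refine ⟨1, fun t ht => dualityGap_le A hε.le fun z' hz' => ?_⟩
      obtain ⟨p, hp, rfl⟩ := hcar z' hz'
      obtain ⟨s, rfl⟩ := Nat.exists_eq_add_of_le' ht
      exact (hG γ _ p (R.mem_behavioral _ s) hp).1.trans hGε
    obtain ⟨hτ3, hτα⟩ := hsmall ε τ hε hGε.le hτ2
    obtain ⟨q', hq', hopt, hdist⟩ := hC τ γ q qHalf hτ hτ3 hτα R
    have hlim := (summable_of_sum_range_le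
      (fun t => Finset.sum_nonneg fun i _ => sq_nonneg _) hdist).tendsto_atTop_zero
    have hlim2 : Filter.Tendsto (fun t => G * √(∑ i, ((X.prod Y).toSeq (q (t + 1)) i
        - (X.prod Y).toSeq q' i) ^ 2)) Filter.atTop (nhds 0) := by
      have := (hlim.sqrt).const_mul G
      rwa [Real.sqrt_zero, mul_zero] at this
    obtain ⟨N, hN⟩ := Filter.eventually_atTop.1 (hlim2.eventually_lt_const (half_pos hε))
    refine ⟨N + 1, fun t ht => dualityGap_le A hε.le fun z' hz' => ?_⟩
    obtain ⟨p, hp, rfl⟩ := hcar z' hz'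
    obtain ⟨s, rfl⟩ := Nat.exists_eq_add_of_le' (show 1 ≤ t by omega)
    refine ((hG γ _ p (R.mem_behavioral _ s) hp).2 τ q' hτ.le hq' (hopt p hp)).trans ?_
    have h1 := hhalf ε τ hε hτ2
    have h2 := hN s (by omega)
    linarith
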